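/- Throughout, a groupoid is a second countable, locally compact, Hausdorff topological groupoid $G$ with unit space $G^0$ and range and domain maps $r,d\colon G\to G^0$. A continuous unitary representation $\pi$ of $G$ consists of a continuous field $(\mathcal H^\pi_u)_{u\in G^0}$ of separable complex Hilbert spaces with space of continuous sections $\Gamma^\pi$, and unitaries $\pi(x)\colon\mathcal H^\pi_{d(x)}\to\mathcal H^\pi_{r(x)}$ ($x\in G$) such that $\pi(u)=\mathrm{id}$ for $u\in G^0$, $\pi(xy)=\pi(x)\pi(y)$ for composable $x,y$, $\pi(x^{-1})=\pi(x)^{-1}$, and $x\mapsto\langle\pi(x)\xi(d(x)),\eta(r(x))\rangle$ is continuous for all $\xi,\eta\in C_0(G^0,\mathcal H^\pi)$, the Hilbert $C_0(G^0)$-module of continuous sections vanishing at infinity. It is assumed that this module is countably generated. For an adjointable operator $T$ on $C_0(G^0,\mathcal H^\pi)$ let $T_u$ be its localization at $u$, i.e. the bounded operator on $\mathcal H^\pi_u$ with $T_u\xi(u)=(T\xi)(u)$. $T$ is Hilbert–Schmidt if $u\mapsto\operatorname{tr}|T_u|^2$ is a (finite-valued) function in $C_0(G^0)$; then $\|T\|_2=\sup_u\|T_u\|_2$.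 The representation $\pi$ is *amenable* if there is a net $(T^i)$ of Hilbert–Schmidt operators on $C_0(G^0,\mathcal H^\pi)$ with $\|T^i\|_2\le 1$ such that $\|T^i_u\|_2\to1$ uniformly on compact subsets of $G^0$ and $\langle\pi(x)T^i_{d(x)}\pi(x)^{-1},T^i_{r(x)}\rangle_{HS}\to1$ uniformly on compact subsets of $G$. Let $\pi$ and $\rho$ be continuous unitary representations of groupoids $G$ and $H$. Their outer tensor product $\pi\times\rho$ is the representation $(x,y)\mapsto\pi(x)\otimes\rho(y)$ of $G\times H$ on the field $(u,v)\mapsto\mathcal H^\pi_u\otimes\mathcal H^\rho_v$ over $G^0\times H^0$, whose continuous sections are the locally uniform limits of finite sums of sections $(u,v)\mapsto\xi(u)\otimes\eta(v)$ with $\xi\in\Gamma^\pi$, $\eta\in\Gamma^\rho$. If $G=H$, the inner tensor product $\pi\otimes\rho$ is the representation $x\mapsto\pi(x)\otimes\rho(x)$ of $G$ on the field $u\mapsto\mathcal H^\pi_u\otimes\mathcal H^\rho_u$, whose continuous sections are the locally uniform limits of finite sums of sections $u\mapsto\xi(u)\otimes\eta(u)$. **Proposition.** (i) If $\pi$ and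 $\rho$ are amenable, then $\pi\times\rho$ is an amenable representation of $G\times H$. (ii) If $G=H$ and $\pi$ and $\rho$ are amenable, then $\pi\otimes\rho$ is an amenable representation of $G$. In both cases the module of continuous sections vanishing at infinity of the tensor product is again countably generated. -/

import Mathlib

open CategoryTheory Filter Topology TensorProduct
open scoped ZeroAtInfty NNReal ENNReal

universe w u v f u' v' f'

noncomputable section

namespace GroupoidRep

/-! ### Topological groupoids

A groupoid is a small category in which every arrow is invertible.  Its objects `X` are the unit
space `G⁰`, and an arrow `x : u ⟶ v` is an element of `G` with domain `d(x) = u` and range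
`r(x) = v`.  The product `y x` of composable elements is the arrow `x ≫ y`. -/

/-- The set `G` of all arrows of the groupoid. -/
@[ext]
structure Arrows (X : Type*) [Groupoid X] where
  src : X
  tgt : X
  hom : src ⟶ tgt

/-- The set of composable pairs of arrows. -/
structure ComposablePair (X : Type*) [Groupoid X] where
  {a b c : X}
  f : a ⟶ b
  g : b ⟶ c

section TopologicalGroupoid

variable {X : Type*} [Groupoid X]

/-- A composable pair as a pair of arrows. -/
def ComposablePair.toProd (p : ComposablePair X) : Arrows X × Arrows X :=
  (⟨p.a, p.b, p.f⟩, ⟨p.b, p.c, p.g⟩)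

/-- Composable pairs carry the subspace topology from pairs of arrows. -/
instance [TopologicalSpace (Arrows X)] : TopologicalSpace (ComposablePair X) :=
  TopologicalSpace.induced ComposablePair.toProd inferInstance

/-- The product of a composable pair. -/
def ComposablePair.comp (p : ComposablePair X) : Arrows X := ⟨p.a, p.c, p.f ≫ p.g⟩

/-- The inverse of an arrow. -/
def Arrows.inv (x : Arrows X) : Arrows X := ⟨x.tgt, x.src, Groupoid.inv x.hom⟩

/-- The unit arrow at an object. -/
def Arrows.unit (u : X) : Arrows X := ⟨u, u, 𝟙 u⟩

variable (X) in
/-- A topological groupoid: inversion and multiplication are continuous, and the unit space has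
the subspace topology from the space of arrows. -/
class IsTopologicalGroupoid [TopologicalSpace X] [TopologicalSpace (Arrows X)] : Prop where
  continuous_inv : Continuous (Arrows.inv : Arrows X → Arrows X)
  continuous_comp : Continuous (ComposablePair.comp : ComposablePair X → Arrows X)
  isInducing_unit : IsInducing (Arrows.unit : X → Arrows X)

variable (X) in
/-- A second countable, locally compact, Hausdorff topological groupoid. -/
class IsLCGroupoid [TopologicalSpace X] [TopologicalSpace (Arrows X)] : Prop
    extends IsTopologicalGroupoid X where
  t2Space : T2Space (Arrows X)
  locallyCompactSpace : LocallyCompactSpace (Arrows X)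
  secondCountableTopology : SecondCountableTopology (Arrows X)

section

variable [TopologicalSpace X] [TopologicalSpace (Arrows X)]

theorem continuous_src [IsTopologicalGroupoid X] : Continuous (Arrows.src : Arrows X → X) := by
  rw [IsTopologicalGroupoid.isInducing_unit.continuous_iff]
  have h1 : Continuous fun x : Arrows X =>
      (⟨x.hom, Groupoid.inv x.hom⟩ : ComposablePair X) :=
    continuous_induced_rng.2 (continuous_id.prodMk IsTopologicalGroupoid.continuous_inv)
  have h2 := IsTopologicalGroupoid.continuous_comp.comp h1
  convert h2 using 1
  funext x
  simp [Arrows.unit, ComposablePair.comp]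

theorem continuous_tgt [IsTopologicalGroupoid X] : Continuous (Arrows.tgt : Arrows X → X) :=
  continuous_src.comp IsTopologicalGroupoid.continuous_inv

theorem isClosedEmbedding_unit [IsLCGroupoid X] :
    IsClosedEmbedding (Arrows.unit : X → Arrows X) := by
  have := IsLCGroupoid.t2Space (X := X)
  have hi := IsTopologicalGroupoid.isInducing_unit (X := X)
  refine ⟨⟨hi, fun u v h => congrArg Arrows.src h⟩, ?_⟩
  have : Set.range (Arrows.unit : X → Arrows X) = {x | Arrows.unit x.src = x} := by
    ext x
    constructor
    · rintro ⟨u, rfl⟩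
      rfl
    · intro h
      exact ⟨_, h⟩
  rw [this]
  exact isClosed_eq (hi.continuous.comp continuous_src) continuous_id

/-- The unit space of a locally compact Hausdorff groupoid is Hausdorff. -/
theorem t2Space_base [IsLCGroupoid X] : T2Space X := by
  have := IsLCGroupoid.t2Space (X := X)
  exact (isClosedEmbedding_unit (X := X)).isEmbedding.t2Space

/-- The unit space of a locally compact Hausdorff groupoid is locally compact. -/
theorem locallyCompactSpace_base [IsLCGroupoid X] : LocallyCompactSpace X := by
  have := IsLCGroupoid.locallyCompactSpace (X := X)
  exact (isClosedEmbedding_unit (X := X)).locallyCompactSpace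

end

end TopologicalGroupoid

section Product

variable {X Y : Type*} [Groupoid X] [Groupoid Y]

/-- An arrow of the product groupoid is a pair of arrows. -/
def Arrows.equivProd : Arrows (X × Y) ≃ Arrows X × Arrows Y where
  toFun x := (⟨x.src.1, x.tgt.1, x.hom.1⟩, ⟨x.src.2, x.tgt.2, x.hom.2⟩)
  invFun p := ⟨(p.1.src, p.2.src), (p.1.tgt, p.2.tgt), (p.1.hom, p.2.hom)⟩
  left_inv _ := rfl
  right_inv _ := rfl

/-- The space of arrows of `G × H` carries the product topology. -/
instance [TopologicalSpace (Arrows X)] [TopologicalSpace (Arrows Y)] :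
    TopologicalSpace (Arrows (X × Y)) :=
  TopologicalSpace.induced Arrows.equivProd inferInstance

variable [TopologicalSpace (Arrows X)] [TopologicalSpace (Arrows Y)]

theorem continuous_equivProd :
    Continuous (Arrows.equivProd : Arrows (X × Y) → Arrows X × Arrows Y) :=
  continuous_induced_dom

variable [TopologicalSpace X] [TopologicalSpace Y]

instance [IsTopologicalGroupoid X] [IsTopologicalGroupoid Y] : IsTopologicalGroupoid (X × Y) where
  continuous_inv := by
    refine continuous_induced_rng.2 ?_
    exact ((IsTopologicalGroupoid.continuous_inv.comp continuous_fst).prodMk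
      (IsTopologicalGroupoid.continuous_inv.comp continuous_snd)).comp continuous_equivProd
  continuous_comp := by
    refine continuous_induced_rng.2 ?_
    have h : Continuous fun p : ComposablePair (X × Y) =>
        ((Arrows.equivProd p.toProd.1, Arrows.equivProd p.toProd.2) :
          (Arrows X × Arrows Y) × (Arrows X × Arrows Y)) :=
      ((continuous_equivProd.comp continuous_fst).prodMk
        (continuous_equivProd.comp continuous_snd)).comp continuous_induced_dom
    have h1 : Continuous fun p : ComposablePair (X × Y) =>
        (⟨p.f.1, p.g.1⟩ : ComposablePair X) :=
      continuous_induced_rng.2 (h.fst.fst.prodMk h.snd.fst)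
    have h2 : Continuous fun p : ComposablePair (X × Y) =>
        (⟨p.f.2, p.g.2⟩ : ComposablePair Y) :=
      continuous_induced_rng.2 (h.fst.snd.prodMk h.snd.snd)
    exact (IsTopologicalGroupoid.continuous_comp.comp h1).prodMk
      (IsTopologicalGroupoid.continuous_comp.comp h2)
  isInducing_unit := by
    have h1 := (IsTopologicalGroupoid.isInducing_unit (X := X)).prodMap
      (IsTopologicalGroupoid.isInducing_unit (X := Y))
    have h2 : IsInducing (Arrows.equivProd : Arrows (X × Y) → Arrows X × Arrows Y) := ⟨rfl⟩
    exact h2.of_comp_iff.1 h1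

instance [IsLCGroupoid X] [IsLCGroupoid Y] : IsLCGroupoid (X × Y) := by
  have := IsLCGroupoid.t2Space (X := X)
  have := IsLCGroupoid.t2Space (X := Y)
  have := IsLCGroupoid.locallyCompactSpace (X := X)
  have := IsLCGroupoid.locallyCompactSpace (X := Y)
  have := IsLCGroupoid.secondCountableTopology (X := X)
  have := IsLCGroupoid.secondCountableTopology (X := Y)
  let e : Arrows (X × Y) ≃ₜ Arrows X × Arrows Y :=
    Arrows.equivProd.toHomeomorphOfIsInducing ⟨rfl⟩
  exact ⟨e.isEmbedding.t2Space, e.isClosedEmbedding.locallyCompactSpace,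
    e.isEmbedding.secondCountableTopology⟩

end Product

/-! ### Continuous fields of Hilbert spaces -/

/-- A continuous field of separable complex Hilbert spaces over `X`, with its space `Γ` of
continuous sections. -/
structure HilbertField (X : Type u) [TopologicalSpace X] where
  fiber : X → Type f
  [normedAddCommGroup : ∀ u, NormedAddCommGroup (fiber u)]
  [innerProductSpace : ∀ u, InnerProductSpace ℂ (fiber u)]
  [completeSpace : ∀ u, CompleteSpace (fiber u)]
  [separableSpace : ∀ u, TopologicalSpace.SeparableSpace (fiber u)]
  Γ : Submodule ℂ (∀ u, fiber u)
  dense : ∀ u, Dense {h : fiber u | ∃ ξ ∈ Γ, ξ u = h}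
  continuous_norm : ∀ ξ ∈ Γ, Continuous fun u => ‖ξ u‖
  mem_of_locally_approx : ∀ ξ : ∀ u, fiber u,
    (∀ u, ∀ ε > (0 : ℝ), ∃ ξ' ∈ Γ, ∀ᶠ s in 𝓝 u, ‖ξ s - ξ' s‖ < ε) → ξ ∈ Γ

attribute [instance] HilbertField.normedAddCommGroup HilbertField.innerProductSpace
  HilbertField.completeSpace HilbertField.separableSpace

namespace HilbertField

variable {X : Type*} [TopologicalSpace X] (𝓗 : HilbertField X)

/-- The module `C₀(X, 𝓗)` of continuous sections vanishing at infinity.  Its `C₀(X)`-valued inner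
product is the pointwise one. -/
def C0 : Submodule ℂ (∀ u, 𝓗.fiber u) where
  carrier := {ξ | ξ ∈ 𝓗.Γ ∧ Tendsto (fun u => ‖ξ u‖) (cocompact X) (𝓝 0)}
  zero_mem' := ⟨𝓗.Γ.zero_mem, by simpa using tendsto_const_nhds⟩
  add_mem' := by
    rintro ξ η ⟨h1, h2⟩ ⟨h3, h4⟩
    refine ⟨𝓗.Γ.add_mem h1 h3, ?_⟩
    refine squeeze_zero (fun u => norm_nonneg _) (fun u => norm_add_le (ξ u) (η u)) ?_
    simpa using h2.add h4
  smul_mem' := by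
    rintro c ξ ⟨h1, h2⟩
    refine ⟨𝓗.Γ.smul_mem c h1, ?_⟩
    simpa [norm_smul] using h2.const_mul ‖c‖

/-- `C₀(X, 𝓗)` is countably generated as a Hilbert `C₀(X)`-module: the `C₀(X)`-linear span of some
countable set of sections is dense for the supremum norm. -/
def CountablyGenerated : Prop :=
  ∃ S : Set (∀ u, 𝓗.fiber u), S.Countable ∧ S ⊆ 𝓗.C0 ∧
    ∀ ξ ∈ 𝓗.C0, ∀ ε > (0 : ℝ), ∃ (n : ℕ) (f : Fin n → C₀(X, ℂ)) (s : Fin n → S),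
      ∀ u, ‖ξ u - ∑ i, f i u • (s i).1 u‖ < ε

variable {𝓗}

theorem continuous_inner {ξ η : ∀ u, 𝓗.fiber u} (hξ : ξ ∈ 𝓗.Γ) (hη : η ∈ 𝓗.Γ) :
    Continuous fun u => inner ℂ (ξ u) (η u) := by
  have h : ∀ c : ℂ, Continuous fun u => ‖ξ u + c • η u‖ := fun c =>
    𝓗.continuous_norm (ξ + c • η) (𝓗.Γ.add_mem hξ (𝓗.Γ.smul_mem c hη))
  have e : (fun u => inner ℂ (ξ u) (η u)) = fun u =>
      (((‖ξ u + (1 : ℂ) • η u‖ : ℂ) ^ 2 - (‖ξ u + (-1 : ℂ) • η u‖ : ℂ) ^ 2 +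
        ((‖ξ u + (-Complex.I) • η u‖ : ℂ) ^ 2 -
          (‖ξ u + Complex.I • η u‖ : ℂ) ^ 2) * Complex.I) / 4) := by
    funext u
    rw [inner_eq_sum_norm_sq_div_four]
    simp [sub_eq_add_neg]
  rw [e]
  have h' : ∀ c : ℂ, Continuous fun u => ((‖ξ u + c • η u‖ : ℝ) : ℂ) := fun c =>
    Complex.continuous_ofReal.comp (h c)
  exact (((((h' 1).pow 2).sub ((h' (-1)).pow 2)).add
    ((((h' (-Complex.I)).pow 2).sub ((h' Complex.I).pow 2)).mul continuous_const))).div_const 4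

theorem smul_mem_Γ {f : X → ℂ} (hf : Continuous f) {ξ : ∀ u, 𝓗.fiber u} (hξ : ξ ∈ 𝓗.Γ) :
    (fun u => f u • ξ u) ∈ 𝓗.Γ := by
  refine 𝓗.mem_of_locally_approx _ fun u ε hε => ⟨f u • ξ, 𝓗.Γ.smul_mem _ hξ, ?_⟩
  have hc : Continuous fun s => ‖f s - f u‖ * ‖ξ s‖ :=
    (hf.sub continuous_const).norm.mul (𝓗.continuous_norm ξ hξ)
  have : Tendsto (fun s => ‖f s - f u‖ * ‖ξ s‖) (𝓝 u) (𝓝 0) := by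
    simpa using hc.tendsto u
  filter_upwards [this.eventually (gt_mem_nhds hε)] with s hs
  simpa [← sub_smul, norm_smul] using hs

theorem exists_mem_C0_eventuallyEq [T2Space X] [LocallyCompactSpace X] {ξ : ∀ u, 𝓗.fiber u}
    (hξ : ξ ∈ 𝓗.Γ) (u : X) : ∃ ζ ∈ 𝓗.C0, ∀ᶠ s in 𝓝 u, ζ s = ξ s := by
  obtain ⟨K, hK, hKu⟩ := exists_compact_mem_nhds u
  obtain ⟨f, hf1, -, hfc, -⟩ := exists_continuous_one_zero_of_isCompact hK isClosed_empty
    (Set.disjoint_empty K)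
  refine ⟨fun s => (f s : ℂ) • ξ s,
    ⟨smul_mem_Γ (Complex.continuous_ofReal.comp f.continuous) hξ, ?_⟩, ?_⟩
  · refine tendsto_const_nhds.congr' ?_
    filter_upwards [hfc.isCompact.compl_mem_cocompact] with s hs
    simp [image_eq_zero_of_notMem_tsupport hs]
  · filter_upwards [hKu] with s hs
    simp [hf1 hs]

/-- Continuous sections take every value: any vector of a fibre is the value of a section in
`C₀(X, 𝓗)`. -/
theorem exists_mem_C0_eq [T2Space X] [LocallyCompactSpace X] (u : X) (h : 𝓗.fiber u) :
    ∃ ζ ∈ 𝓗.C0, ζ u = h := by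
  suffices ∃ ζ ∈ 𝓗.Γ, ζ u = h by
    obtain ⟨ζ, hζ, rfl⟩ := this
    obtain ⟨ζ', h1, h2⟩ := exists_mem_C0_eventuallyEq hζ u
    exact ⟨ζ', h1, h2.self_of_nhds⟩
  let D : Submodule ℂ (𝓗.fiber u) := 𝓗.Γ.map (LinearMap.proj u)
  have hD : h ∈ closure (D.toAddSubgroup : Set (𝓗.fiber u)) := by
    have h1 : (D.toAddSubgroup : Set (𝓗.fiber u)) = {h | ∃ ξ ∈ 𝓗.Γ, ξ u = h} := rfl
    rw [h1]
    exact 𝓗.dense u h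
  obtain ⟨v, hv1, hv2, -, hv3⟩ := controlled_sum_of_mem_closure hD
    (b := fun n => (1 / 2 : ℝ) ^ n) (fun n => by positivity)
  have key : ∀ n, ∃ ζ ∈ 𝓗.Γ, ζ u = v n ∧ (0 < n → ∀ s, ‖ζ s‖ ≤ (1 / 2 : ℝ) ^ n) := by
    intro n
    obtain ⟨ξ, hξ, hξu⟩ : ∃ ξ ∈ 𝓗.Γ, ξ u = v n := hv2 n
    by_cases hn : 0 < n
    · have ho : IsOpen {s | ‖ξ s‖ < (1 / 2 : ℝ) ^ n} :=
        isOpen_lt (𝓗.continuous_norm ξ hξ) continuous_const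
      obtain ⟨f, hf1, hf0, -, hfI⟩ := exists_continuous_one_zero_of_isCompact
        (isCompact_singleton (x := u)) ho.isClosed_compl (by
          rw [Set.disjoint_singleton_left]
          simpa [hξu] using hv3 n hn)
      refine ⟨fun s => (f s : ℂ) • ξ s,
        smul_mem_Γ (Complex.continuous_ofReal.comp f.continuous) hξ, ?_, fun _ s => ?_⟩
      · simp [hf1 rfl, hξu]
      · by_cases hs : ‖ξ s‖ < (1 / 2 : ℝ) ^ n
        · rw [norm_smul, Complex.norm_real, Real.norm_of_nonneg (hfI s).1]
          exact (mul_le_of_le_one_left (norm_nonneg _) (hfI s).2).trans hs.le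
        · have : f s = 0 := hf0 hs
          simp [this]
    · exact ⟨ξ, hξ, hξu, fun h => absurd h hn⟩
  choose ζ hζ hζu hζn using key
  have hsum : ∀ s, Summable fun n => ζ (n + 1) s := fun s =>
    Summable.of_norm_bounded ((summable_nat_add_iff 1).2 summable_geometric_two)
      fun n => hζn (n + 1) n.succ_pos s
  refine ⟨fun s => ζ 0 s + ∑' n, ζ (n + 1) s, 𝓗.mem_of_locally_approx _ fun w ε hε => ?_, ?_⟩
  · obtain ⟨N, hN⟩ := exists_pow_lt_of_lt_one hε (show (1 / 2 : ℝ) < 1 by norm_num)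
    refine ⟨ζ 0 + ∑ n ∈ Finset.range N, ζ (n + 1),
      𝓗.Γ.add_mem (hζ 0) (𝓗.Γ.sum_mem fun n _ => hζ _), Eventually.of_forall fun s => ?_⟩
    have h1 : (ζ 0 s + ∑' n, ζ (n + 1) s) - (ζ 0 + ∑ n ∈ Finset.range N, ζ (n + 1)) s =
        ∑' n, ζ (n + N + 1) s := by
      rw [← (hsum s).sum_add_tsum_nat_add N]
      simp
    rw [h1]
    have h2 : HasSum (fun n => (1 / 2 : ℝ) ^ (n + N + 1)) ((1 / 2 : ℝ) ^ N) := by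
      have h3 := hasSum_geometric_two.mul_left ((1 / 2 : ℝ) ^ (N + 1))
      have h4 : (1 / 2 : ℝ) ^ (N + 1) * 2 = (1 / 2 : ℝ) ^ N := by
        rw [pow_succ]
        ring
      rw [h4] at h3
      have h5 : (fun n => (1 / 2 : ℝ) ^ (n + N + 1)) =
          fun n => (1 / 2 : ℝ) ^ (N + 1) * (1 / 2 : ℝ) ^ n := by
        funext n
        rw [← pow_add]
        congr 1
        ring
      rw [h5]
      exact h3
    exact (tsum_of_norm_bounded h2 fun n => hζn _ (Nat.succ_pos _) s).trans_lt hN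
  · have h1 : Tendsto (fun n => ∑ k ∈ Finset.range (n + 1), v k) atTop
        (𝓝 (ζ 0 u + ∑' n, ζ (n + 1) u)) := by
      have := ((hsum u).hasSum.tendsto_sum_nat).const_add (ζ 0 u)
      refine this.congr fun n => ?_
      rw [Finset.sum_range_succ', add_comm, ← hζu 0]
      congr 1
      exact Finset.sum_congr rfl fun k _ => hζu _
    exact tendsto_nhds_unique h1 hv1

end HilbertField

/-! ### Adjointable operators and their localisations -/

/-- An adjointable operator on the Hilbert `C₀(X)`-module `C₀(X, 𝓗)`. -/
structure AdjointableOp {X : Type*} [TopologicalSpace X] (𝓗 : HilbertField X) where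
  toFun : 𝓗.C0 → 𝓗.C0
  exists_adjoint : ∃ S : 𝓗.C0 → 𝓗.C0, ∀ ξ η : 𝓗.C0, ∀ u,
    inner ℂ ((toFun ξ).1 u) (η.1 u) = inner ℂ (ξ.1 u) ((S η).1 u)

namespace AdjointableOp

variable {X : Type*} [TopologicalSpace X] {𝓗 : HilbertField X} (T : AdjointableOp 𝓗)

/-- The localisation `T_u` of `T` at `u`, that is the bounded operator on the fibre at `u` with
`T_u (ξ u) = (T ξ) u` for all sections `ξ`; see `localization_apply`. -/
def localization (u : X) : 𝓗.fiber u →L[ℂ] 𝓗.fiber u :=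
  Classical.epsilon fun A => ∀ ξ : 𝓗.C0, A (ξ.1 u) = (T.toFun ξ).1 u

theorem localization_apply [T2Space X] [LocallyCompactSpace X] (u : X) (ξ : 𝓗.C0) :
    T.localization u (ξ.1 u) = (T.toFun ξ).1 u := by
  suffices ∃ A : 𝓗.fiber u →L[ℂ] 𝓗.fiber u, ∀ ξ : 𝓗.C0, A (ξ.1 u) = (T.toFun ξ).1 u from
    Classical.epsilon_spec this ξ
  obtain ⟨S, hS⟩ := T.exists_adjoint
  have hσ : ∀ h : 𝓗.fiber u, ∃ ζ : 𝓗.C0, ζ.1 u = h := fun h =>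
    let ⟨ζ, h1, h2⟩ := HilbertField.exists_mem_C0_eq u h
    ⟨⟨ζ, h1⟩, h2⟩
  choose σ hσ using hσ
  let A : 𝓗.fiber u → 𝓗.fiber u := fun h => (T.toFun (σ h)).1 u
  let B : 𝓗.fiber u → 𝓗.fiber u := fun h => (S (σ h)).1 u
  have hAB : ∀ h k, inner ℂ (A h) k = inner ℂ h (B k) := fun h k => by
    have := hS (σ h) (σ k) u
    rwa [hσ, hσ] at this
  let L : 𝓗.fiber u →ₗ[ℂ] 𝓗.fiber u :=
    { toFun := A
      map_add' := fun h k => ext_inner_right ℂ fun w => by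
        simp only [inner_add_left, hAB]
      map_smul' := fun c h => ext_inner_right ℂ fun w => by
        simp only [inner_smul_left, hAB, RingHom.id_apply] }
  have hL : Continuous L := by
    refine L.continuous_of_seq_closed_graph fun a x y hx hy => ?_
    refine ext_inner_right ℂ fun w => ?_
    have h1 : Tendsto (fun n => inner ℂ (L (a n)) w) atTop (𝓝 (inner ℂ y w)) :=
      hy.inner tendsto_const_nhds
    have h2 : Tendsto (fun n => inner ℂ (a n) (B w)) atTop (𝓝 (inner ℂ x (B w))) :=
      hx.inner tendsto_const_nhds
    rw [show inner ℂ (L x) w = inner ℂ x (B w) from hAB x w]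
    exact tendsto_nhds_unique h1 (h2.congr fun n => (hAB (a n) w).symm)
  refine ⟨⟨L, hL⟩, fun ξ => ext_inner_right ℂ fun w => ?_⟩
  have h1 := hS ξ (σ w) u
  rw [hσ] at h1
  rw [h1]
  exact hAB _ _

end AdjointableOp

/-! ### Hilbert-Schmidt operators -/

section HilbertSchmidt

variable {E : Type*} [NormedAddCommGroup E] [InnerProductSpace ℂ E] [CompleteSpace E]

variable (E) in
/-- The index set of a chosen orthonormal basis of a Hilbert space. -/
def basisSet : Set E := (exists_hilbertBasis ℂ E).choose

variable (E) in
/-- A chosen orthonormal basis of a Hilbert space. -/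
def stdBasis : HilbertBasis (basisSet E) ℂ E := (exists_hilbertBasis ℂ E).choose_spec.choose

/-- `tr |A|² = ∑ ‖A e‖²`, the sum over an orthonormal basis, in `[0, ∞]`. -/
def hsSq (A : E →L[ℂ] E) : ℝ≥0∞ := ∑' i, ‖A (stdBasis E i)‖ₑ ^ 2

/-- The Hilbert-Schmidt norm `‖A‖₂`, in `[0, ∞]`. -/
def hsNorm (A : E →L[ℂ] E) : ℝ≥0∞ := hsSq A ^ (1 / 2 : ℝ)

/-- The Hilbert-Schmidt inner product `⟨A, B⟩ = tr (B* A) = ∑ ⟨A e, B e⟩`, linear in `A`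
(Mathlib's `inner` is linear in its second argument). -/
def hsInner (A B : E →L[ℂ] E) : ℂ := ∑' i, inner ℂ (B (stdBasis E i)) (A (stdBasis E i))

end HilbertSchmidt

namespace AdjointableOp

variable {X : Type*} [TopologicalSpace X] {𝓗 : HilbertField X} (T : AdjointableOp 𝓗)

/-- `T` is a Hilbert-Schmidt operator on `C₀(X, 𝓗)`: the function `u ↦ tr |T_u|²` is finite and
belongs to `C₀(X)`. -/
def IsHilbertSchmidt : Prop := ∃ f : C₀(X, ℝ≥0), ∀ u, hsSq (T.localization u) = f u

/-- The norm `‖T‖₂ = sup_u ‖T_u‖₂` of the Hilbert module of Hilbert-Schmidt operators. -/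
def moduleHSNorm : ℝ≥0∞ := ⨆ u, hsNorm (T.localization u)

end AdjointableOp

/-! ### Unitary representations and amenability -/

/-- A continuous unitary representation of a groupoid on a continuous field of Hilbert spaces. -/
structure UnitaryRep (X : Type u) [Groupoid.{v} X] [TopologicalSpace X]
    [TopologicalSpace (Arrows X)] where
  field : HilbertField.{u, f} X
  map : ∀ {u v : X}, (u ⟶ v) → (field.fiber u ≃ₗᵢ[ℂ] field.fiber v)
  map_id : ∀ u h, map (𝟙 u) h = h
  map_comp : ∀ {u v w : X} (x : u ⟶ v) (y : v ⟶ w) h, map (x ≫ y) h = map y (map x h)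
  map_inv : ∀ {u v : X} (x : u ⟶ v) h, (map x).symm h = map (Groupoid.inv x) h
  continuous_coeff : ∀ ξ ∈ field.C0, ∀ η ∈ field.C0,
    Continuous fun x : Arrows X => inner ℂ (map x.hom (ξ x.src)) (η x.tgt)

namespace UnitaryRep

variable {X : Type*} [Groupoid X] [TopologicalSpace X] [TopologicalSpace (Arrows X)]

/-- The action `x · A = π(x) A π(x)⁻¹` on operators. -/
def act (π : UnitaryRep X) (x : Arrows X) (A : π.field.fiber x.src →L[ℂ] π.field.fiber x.src) :
    π.field.fiber x.tgt →L[ℂ] π.field.fiber x.tgt :=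
  (π.map x.hom : π.field.fiber x.src →L[ℂ] π.field.fiber x.tgt) ∘L A ∘L
    ((π.map x.hom).symm : π.field.fiber x.tgt →L[ℂ] π.field.fiber x.src)

end UnitaryRep

/-- `π` is amenable: there is a net (indexed by a nonempty directed set) of Hilbert-Schmidt
operators `Tⁱ` on `C₀(X, 𝓗)` with `‖Tⁱ‖₂ ≤ 1`, such that `‖Tⁱ_u‖₂ → 1` uniformly on compact sets of
units and `⟨x · Tⁱ_{d(x)}, Tⁱ_{r(x)}⟩ → 1` uniformly on compact sets of arrows. -/
def UnitaryRep.IsAmenable {X : Type u} [Groupoid.{v} X] [TopologicalSpace X]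
    [TopologicalSpace (Arrows X)] (π : UnitaryRep.{u, v, f} X) : Prop :=
  ∃ (ι : Type w) (_ : Preorder ι) (_ : IsDirected ι (· ≤ ·)) (_ : Nonempty ι)
    (T : ι → AdjointableOp π.field),
    (∀ i, (T i).IsHilbertSchmidt ∧ (T i).moduleHSNorm ≤ 1) ∧
    (∀ K : Set X, IsCompact K →
      TendstoUniformlyOn (fun i u => (hsNorm ((T i).localization u)).toReal) (fun _ => 1) atTop K) ∧
    (∀ K : Set (Arrows X), IsCompact K →
      TendstoUniformlyOn
        (fun i x => hsInner (π.act x ((T i).localization x.src)) ((T i).localization x.tgt))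
        (fun _ => 1) atTop K)

/-! ### Tensor products of continuous fields -/

namespace HilbertField

variable {X : Type u} {Y : Type u'} {Z : Type*} [TopologicalSpace X] [TopologicalSpace Y]
  [TopologicalSpace Z] (𝓗 : HilbertField.{u, f} X) (𝓚 : HilbertField.{u', f'} Y)
  (a : Z → X) (b : Z → Y)

/-- The section `z ↦ ξ (a z) ⊗ η (b z)` of the field of Hilbert space tensor products (completions
of the algebraic ones) `z ↦ 𝓗_{a z} ⊗ 𝓚_{b z}`. -/
def pureSection (ξ : ∀ u, 𝓗.fiber u) (η : ∀ u, 𝓚.fiber u) (z : Z) :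
    UniformSpace.Completion (𝓗.fiber (a z) ⊗[ℂ] 𝓚.fiber (b z)) :=
  ((ξ (a z) ⊗ₜ[ℂ] η (b z) : 𝓗.fiber (a z) ⊗[ℂ] 𝓚.fiber (b z)) :
    UniformSpace.Completion (𝓗.fiber (a z) ⊗[ℂ] 𝓚.fiber (b z)))

/-- The linear span of the sections `ξ ⊗ η` with `ξ`, `η` continuous. -/
def algTensorSections :
    Submodule ℂ (∀ z, UniformSpace.Completion (𝓗.fiber (a z) ⊗[ℂ] 𝓚.fiber (b z))) :=
  Submodule.span ℂ {σ | ∃ ξ ∈ 𝓗.Γ, ∃ η ∈ 𝓚.Γ, σ = pureSection 𝓗 𝓚 a b ξ η}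

/-- The continuous sections of the tensor product field: the sections that are locally uniform
limits of finite sums of sections `ξ ⊗ η`. -/
def tensorSections :
    Submodule ℂ (∀ z, UniformSpace.Completion (𝓗.fiber (a z) ⊗[ℂ] 𝓚.fiber (b z))) where
  carrier := {σ | ∀ z, ∀ ε > (0 : ℝ), ∃ τ ∈ algTensorSections 𝓗 𝓚 a b,
    ∀ᶠ s in 𝓝 z, ‖σ s - τ s‖ < ε}
  zero_mem' := fun z ε hε => ⟨0, Submodule.zero_mem _, by simp [hε]⟩
  add_mem' := by
    intro σ σ' h h' z ε hε
    obtain ⟨τ, hτ, h1⟩ := h z (ε / 2) (half_pos hε)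
    obtain ⟨τ', hτ', h2⟩ := h' z (ε / 2) (half_pos hε)
    refine ⟨τ + τ', Submodule.add_mem _ hτ hτ', ?_⟩
    filter_upwards [h1, h2] with s h3 h4
    have : (σ + σ') s - (τ + τ') s = (σ s - τ s) + (σ' s - τ' s) := by
      simp only [Pi.add_apply]
      abel
    rw [this]
    linarith [norm_add_le (σ s - τ s) (σ' s - τ' s)]
  smul_mem' := by
    intro c σ h z ε hε
    obtain ⟨τ, hτ, h1⟩ := h z (ε / (‖c‖ + 1)) (by positivity)
    refine ⟨c • τ, Submodule.smul_mem _ c hτ, ?_⟩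
    filter_upwards [h1] with s h2
    have : (c • σ) s - (c • τ) s = c • (σ s - τ s) := by simp [smul_sub]
    rw [this, norm_smul]
    rw [lt_div_iff₀ (by positivity)] at h2
    nlinarith [norm_nonneg (σ s - τ s), norm_nonneg c]

variable {𝓗 𝓚 a b}

theorem algTensorSections_le : algTensorSections 𝓗 𝓚 a b ≤ tensorSections 𝓗 𝓚 a b :=
  fun σ hσ _ ε hε => ⟨σ, hσ, by simp [hε]⟩

theorem continuous_inner_alg (ha : Continuous a) (hb : Continuous b)
    {σ τ : ∀ z, UniformSpace.Completion (𝓗.fiber (a z) ⊗[ℂ] 𝓚.fiber (b z))}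
    (hσ : σ ∈ algTensorSections 𝓗 𝓚 a b) (hτ : τ ∈ algTensorSections 𝓗 𝓚 a b) :
    Continuous fun z => inner ℂ (σ z) (τ z) := by
  induction hσ, hτ using Submodule.span_induction₂ with
  | mem_mem σ τ h h' =>
    obtain ⟨ξ, hξ, η, hη, rfl⟩ := h
    obtain ⟨ξ', hξ', η', hη', rfl⟩ := h'
    simp only [pureSection, UniformSpace.Completion.inner_coe, TensorProduct.inner_tmul]
    exact ((continuous_inner hξ hξ').comp ha).mul ((continuous_inner hη hη').comp hb)
  | zero_left => simpa using continuous_const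
  | zero_right => simpa using continuous_const
  | add_left x y z _ _ _ h1 h2 =>
    simp only [Pi.add_apply, inner_add_left]
    exact h1.add h2
  | add_right x y z _ _ _ h1 h2 =>
    simp only [Pi.add_apply, inner_add_right]
    exact h1.add h2
  | smul_left r x y _ _ h => simpa [inner_smul_left] using h.const_mul _
  | smul_right r x y _ _ h => simpa [inner_smul_right] using h.const_mul _

theorem continuous_norm_alg (ha : Continuous a) (hb : Continuous b)
    {σ : ∀ z, UniformSpace.Completion (𝓗.fiber (a z) ⊗[ℂ] 𝓚.fiber (b z))}
    (hσ : σ ∈ algTensorSections 𝓗 𝓚 a b) : Continuous fun z => ‖σ z‖ := by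
  have h := Real.continuous_sqrt.comp
    (Complex.continuous_re.comp (continuous_inner_alg ha hb hσ hσ))
  have e : (fun z => ‖σ z‖) = fun z => Real.sqrt (Complex.re (inner ℂ (σ z) (σ z))) :=
    funext fun z => norm_eq_sqrt_re_inner (𝕜 := ℂ) (σ z)
  rw [e]
  exact h

/-- A function that is locally a uniform limit of continuous functions is continuous. -/
theorem continuous_of_approx {Z : Type*} [TopologicalSpace Z] {E : Type*} [PseudoMetricSpace E]
    {F : Z → E} (h : ∀ z, ∀ ε > (0 : ℝ), ∃ g : Z → E, ContinuousAt g z ∧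
      ∀ᶠ s in 𝓝 z, dist (F s) (g s) < ε) : Continuous F := by
  rw [continuous_iff_continuousAt]
  intro z
  rw [ContinuousAt, Metric.tendsto_nhds]
  intro ε hε
  obtain ⟨g, hg, hFg⟩ := h z (ε / 3) (by positivity)
  filter_upwards [hFg, Metric.tendsto_nhds.1 hg (ε / 3) (by positivity)] with s h1 h2
  have h3 := hFg.self_of_nhds
  rw [dist_comm] at h3
  linarith [dist_triangle4 (F s) (g s) (g z) (F z)]

theorem dense_tensorSections (z : Z) :
    Dense {h | ∃ σ ∈ tensorSections 𝓗 𝓚 a b, σ z = h} := by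
  let D : Submodule ℂ (UniformSpace.Completion (𝓗.fiber (a z) ⊗[ℂ] 𝓚.fiber (b z))) :=
    (tensorSections 𝓗 𝓚 a b).map (LinearMap.proj z)
  change Dense (D : Set (UniformSpace.Completion (𝓗.fiber (a z) ⊗[ℂ] 𝓚.fiber (b z))))
  have key : ∀ t : 𝓗.fiber (a z) ⊗[ℂ] 𝓚.fiber (b z),
      (t : UniformSpace.Completion (𝓗.fiber (a z) ⊗[ℂ] 𝓚.fiber (b z))) ∈
        D.topologicalClosure := by
    intro t
    induction t with
    | zero =>
      rw [UniformSpace.Completion.coe_zero]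
      exact D.topologicalClosure.zero_mem
    | add x y hx hy =>
      rw [UniformSpace.Completion.coe_add]
      exact D.topologicalClosure.add_mem hx hy
    | tmul x y =>
      have hc : Continuous fun p : 𝓗.fiber (a z) × 𝓚.fiber (b z) =>
          ((p.1 ⊗ₜ[ℂ] p.2 : 𝓗.fiber (a z) ⊗[ℂ] 𝓚.fiber (b z)) :
            UniformSpace.Completion (𝓗.fiber (a z) ⊗[ℂ] 𝓚.fiber (b z))) :=
        (UniformSpace.Completion.continuous_coe _).comp TensorProduct.continuous_tmul
      have hd := (𝓗.dense (a z)).prod (𝓚.dense (b z)) (x, y)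
      refine map_mem_closure (f := fun p : 𝓗.fiber (a z) × 𝓚.fiber (b z) =>
          ((p.1 ⊗ₜ[ℂ] p.2 : 𝓗.fiber (a z) ⊗[ℂ] 𝓚.fiber (b z)) :
            UniformSpace.Completion (𝓗.fiber (a z) ⊗[ℂ] 𝓚.fiber (b z)))) hc hd ?_
      rintro ⟨_, _⟩ ⟨⟨ξ, hξ, rfl⟩, ⟨η, hη, rfl⟩⟩
      exact ⟨pureSection 𝓗 𝓚 a b ξ η,
        algTensorSections_le (Submodule.subset_span ⟨ξ, hξ, η, hη, rfl⟩), rfl⟩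
  have h2 : Dense (D.topologicalClosure :
      Set (UniformSpace.Completion (𝓗.fiber (a z) ⊗[ℂ] 𝓚.fiber (b z)))) :=
    (UniformSpace.Completion.denseRange_coe).mono (by
      rintro _ ⟨t, rfl⟩
      exact key t)
  rw [Submodule.topologicalClosure_coe] at h2
  exact dense_closure.1 h2

theorem separableSpace_tensor {E F : Type*} [NormedAddCommGroup E] [InnerProductSpace ℂ E]
    [NormedAddCommGroup F] [InnerProductSpace ℂ F] [TopologicalSpace.SeparableSpace E]
    [TopologicalSpace.SeparableSpace F] : TopologicalSpace.SeparableSpace (E ⊗[ℂ] F) := by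
  have h1 : TopologicalSpace.IsSeparable (Set.range fun p : E × F => p.1 ⊗ₜ[ℂ] p.2) :=
    TopologicalSpace.isSeparable_range TensorProduct.continuous_tmul
  have h2 := h1.span (R := ℂ)
  have h3 : Submodule.span ℂ (Set.range fun p : E × F => p.1 ⊗ₜ[ℂ] p.2) = ⊤ := by
    rw [← TensorProduct.span_tmul_eq_top ℂ E F]
    congr 1
    ext t
    simp
  rw [h3] at h2
  exact TopologicalSpace.isSeparable_univ_iff.1 h2

variable (𝓗 𝓚)

/-- The tensor product field over `Z`, with fibre `𝓗_{a z} ⊗ 𝓚_{b z}` at `z`.  For `Z = X × Y` and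
the two projections it is the outer tensor product, for `Z = X = Y` and identity maps the inner
(fibrewise) one. -/
@[reducible]
def tensor (ha : Continuous a) (hb : Continuous b) : HilbertField.{_, max f f'} Z where
  fiber z := UniformSpace.Completion (𝓗.fiber (a z) ⊗[ℂ] 𝓚.fiber (b z))
  separableSpace z := by
    have : TopologicalSpace.SeparableSpace (𝓗.fiber (a z) ⊗[ℂ] 𝓚.fiber (b z)) :=
      separableSpace_tensor
    infer_instance
  Γ := tensorSections 𝓗 𝓚 a b
  dense := dense_tensorSections
  continuous_norm σ hσ := by
    refine continuous_of_approx fun z ε hε => ?_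
    obtain ⟨τ, hτ, h⟩ := hσ z ε hε
    refine ⟨fun s => ‖τ s‖, (continuous_norm_alg ha hb hτ).continuousAt, ?_⟩
    filter_upwards [h] with s hs
    exact (abs_norm_sub_norm_le _ _).trans_lt hs
  mem_of_locally_approx σ hσ z ε hε := by
    obtain ⟨σ', hσ', h1⟩ := hσ z (ε / 2) (half_pos hε)
    obtain ⟨τ, hτ, h2⟩ := hσ' z (ε / 2) (half_pos hε)
    refine ⟨τ, hτ, ?_⟩
    filter_upwards [h1, h2] with s h3 h4
    linarith [norm_sub_le_norm_sub_add_norm_sub (σ s) (σ' s) (τ s)]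

end HilbertField

/-! ### Tensor products of representations -/

section TensorMap

variable {E E' E'' F F' F'' : Type*} [NormedAddCommGroup E] [InnerProductSpace ℂ E]
  [NormedAddCommGroup E'] [InnerProductSpace ℂ E'] [NormedAddCommGroup E'']
  [InnerProductSpace ℂ E''] [NormedAddCommGroup F] [InnerProductSpace ℂ F]
  [NormedAddCommGroup F'] [InnerProductSpace ℂ F'] [NormedAddCommGroup F'']
  [InnerProductSpace ℂ F'']

/-- The unitary operator `U ⊗ V` between Hilbert space tensor products. -/
def tensorMap (U : E ≃ₗᵢ[ℂ] E') (V : F ≃ₗᵢ[ℂ] F') :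
    UniformSpace.Completion (E ⊗[ℂ] F) ≃ₗᵢ[ℂ] UniformSpace.Completion (E' ⊗[ℂ] F') :=
  (TensorProduct.congrIsometry U V).toLinearEquiv.extendOfIsometry
    (UniformSpace.Completion.toComplₗᵢ (𝕜 := ℂ) (E := E ⊗[ℂ] F)).toLinearMap
    (UniformSpace.Completion.toComplₗᵢ (𝕜 := ℂ) (E := E' ⊗[ℂ] F')).toLinearMap
    UniformSpace.Completion.denseRange_coe UniformSpace.Completion.denseRange_coe
    (fun t => (UniformSpace.Completion.norm_coe _).trans
      (((TensorProduct.congrIsometry U V).norm_map t).trans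
        (UniformSpace.Completion.norm_coe _).symm))

theorem tensorMap_tmul (U : E ≃ₗᵢ[ℂ] E') (V : F ≃ₗᵢ[ℂ] F') (x : E) (y : F) :
    tensorMap U V ((x ⊗ₜ[ℂ] y : E ⊗[ℂ] F) : UniformSpace.Completion (E ⊗[ℂ] F)) =
      ((U x ⊗ₜ[ℂ] V y : E' ⊗[ℂ] F') : UniformSpace.Completion (E' ⊗[ℂ] F')) :=
  LinearEquiv.extendOfIsometry_eq _ _ _ _ _ _ (x ⊗ₜ[ℂ] y)

/-- Continuous linear maps out of a Hilbert space tensor product agree if they agree on elementary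
tensors. -/
theorem tensor_ext {W : Type*} [NormedAddCommGroup W] [NormedSpace ℂ W]
    {A B : UniformSpace.Completion (E ⊗[ℂ] F) →L[ℂ] W}
    (h : ∀ (x : E) (y : F), A ((x ⊗ₜ[ℂ] y : E ⊗[ℂ] F) : UniformSpace.Completion (E ⊗[ℂ] F)) =
      B ((x ⊗ₜ[ℂ] y : E ⊗[ℂ] F) : UniformSpace.Completion (E ⊗[ℂ] F))) : A = B := by
  ext z
  induction z using UniformSpace.Completion.induction_on with
  | hp => exact isClosed_eq A.continuous B.continuous
  | ih t =>
    induction t with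
    | zero => rw [UniformSpace.Completion.coe_zero, map_zero, map_zero]
    | tmul x y => exact h x y
    | add s t hs ht => rw [UniformSpace.Completion.coe_add, map_add, map_add, hs, ht]

theorem tensorMap_id (U : E ≃ₗᵢ[ℂ] E) (V : F ≃ₗᵢ[ℂ] F) (hU : ∀ x, U x = x) (hV : ∀ y, V y = y)
    (z : UniformSpace.Completion (E ⊗[ℂ] F)) : tensorMap U V z = z := by
  have h : (tensorMap U V).toContinuousLinearEquiv.toContinuousLinearMap =
      ContinuousLinearMap.id ℂ (UniformSpace.Completion (E ⊗[ℂ] F)) := by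
    refine tensor_ext fun x y => ?_
    have := tensorMap_tmul U V x y
    rw [hU, hV] at this
    exact this
  exact DFunLike.congr_fun h z

theorem tensorMap_comp (U : E ≃ₗᵢ[ℂ] E') (V : F ≃ₗᵢ[ℂ] F') (U' : E' ≃ₗᵢ[ℂ] E'')
    (V' : F' ≃ₗᵢ[ℂ] F'') (U'' : E ≃ₗᵢ[ℂ] E'') (V'' : F ≃ₗᵢ[ℂ] F'')
    (hU : ∀ x, U'' x = U' (U x)) (hV : ∀ y, V'' y = V' (V y))
    (z : UniformSpace.Completion (E ⊗[ℂ] F)) :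
    tensorMap U'' V'' z = tensorMap U' V' (tensorMap U V z) := by
  have h : (tensorMap U'' V'').toContinuousLinearEquiv.toContinuousLinearMap =
      (tensorMap U' V').toContinuousLinearEquiv.toContinuousLinearMap ∘L
        (tensorMap U V).toContinuousLinearEquiv.toContinuousLinearMap := by
    refine tensor_ext fun x y => ?_
    change tensorMap U'' V'' _ = tensorMap U' V' (tensorMap U V _)
    rw [tensorMap_tmul, tensorMap_tmul, tensorMap_tmul, hU, hV]
  exact DFunLike.congr_fun h z

theorem tensorMap_symm (U : E ≃ₗᵢ[ℂ] E') (V : F ≃ₗᵢ[ℂ] F') (U' : E' ≃ₗᵢ[ℂ] E)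
    (V' : F' ≃ₗᵢ[ℂ] F) (hU : ∀ x, U.symm x = U' x) (hV : ∀ y, V.symm y = V' y)
    (z : UniformSpace.Completion (E' ⊗[ℂ] F')) : (tensorMap U V).symm z = tensorMap U' V' z := by
  rw [LinearIsometryEquiv.symm_apply_eq, ← tensorMap_comp U' V' U V
    (LinearIsometryEquiv.refl ℂ E') (LinearIsometryEquiv.refl ℂ F')
    (fun x => by simp [← hU]) (fun y => by simp [← hV])]
  exact (tensorMap_id _ _ (fun _ => rfl) (fun _ => rfl) z).symm

end TensorMap

namespace UnitaryRep

variable {X : Type u} [Groupoid.{v} X] [TopologicalSpace X] [TopologicalSpace (Arrows X)]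
  {Y : Type u'} [Groupoid.{v'} Y] [TopologicalSpace Y] [TopologicalSpace (Arrows Y)]

theorem continuous_coeff_Γ [IsLCGroupoid X] (π : UnitaryRep.{u, v, f} X)
    {ξ η : ∀ u, π.field.fiber u} (hξ : ξ ∈ π.field.Γ) (hη : η ∈ π.field.Γ) :
    Continuous fun x : Arrows X => inner ℂ (π.map x.hom (ξ x.src)) (η x.tgt) := by
  have := t2Space_base (X := X)
  have := locallyCompactSpace_base (X := X)
  rw [continuous_iff_continuousAt]
  intro x
  obtain ⟨ξ', hξ', h1⟩ := HilbertField.exists_mem_C0_eventuallyEq hξ x.src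
  obtain ⟨η', hη', h2⟩ := HilbertField.exists_mem_C0_eventuallyEq hη x.tgt
  refine (π.continuous_coeff ξ' hξ' η' hη').continuousAt.congr ?_
  filter_upwards [continuous_src.continuousAt.eventually h1,
    continuous_tgt.continuousAt.eventually h2] with y h3 h4
  rw [h3, h4]

variable {Z : Type*} [Groupoid Z] [TopologicalSpace (Arrows Z)]

/-- The map induced by a functor on arrows. -/
def _root_.GroupoidRep.Arrows.mapFunctor (F : Z ⥤ X) (x : Arrows Z) : Arrows X :=
  ⟨F.obj x.src, F.obj x.tgt, F.map x.hom⟩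

theorem continuous_obj_of_continuous_arrows [TopologicalSpace Z] [IsTopologicalGroupoid X] [IsTopologicalGroupoid Z]
    {F : Z ⥤ X} (hF : Continuous (Arrows.mapFunctor F)) : Continuous F.obj := by
  have h := continuous_src.comp (hF.comp (IsTopologicalGroupoid.isInducing_unit (X := Z)).continuous)
  exact h

theorem continuous_coeff_alg [IsLCGroupoid X] [IsLCGroupoid Y] (π : UnitaryRep.{u, v, f} X)
    (ρ : UnitaryRep.{u', v', f'} Y) {F : Z ⥤ X} {F' : Z ⥤ Y}
    (hF : Continuous (Arrows.mapFunctor F)) (hF' : Continuous (Arrows.mapFunctor F'))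
    {σ τ : ∀ z, UniformSpace.Completion
      (π.field.fiber (F.obj z) ⊗[ℂ] ρ.field.fiber (F'.obj z))}
    (hσ : σ ∈ HilbertField.algTensorSections π.field ρ.field F.obj F'.obj)
    (hτ : τ ∈ HilbertField.algTensorSections π.field ρ.field F.obj F'.obj) :
    Continuous fun x : Arrows Z =>
      inner ℂ (tensorMap (π.map (F.map x.hom)) (ρ.map (F'.map x.hom)) (σ x.src)) (τ x.tgt) := by
  induction hσ, hτ using Submodule.span_induction₂ with
  | mem_mem σ τ h h' =>
    obtain ⟨ξ, hξ, η, hη, rfl⟩ := h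
    obtain ⟨ξ', hξ', η', hη', rfl⟩ := h'
    simp only [HilbertField.pureSection, tensorMap_tmul, UniformSpace.Completion.inner_coe,
      TensorProduct.inner_tmul]
    exact ((π.continuous_coeff_Γ hξ hξ').comp hF).mul ((ρ.continuous_coeff_Γ hη hη').comp hF')
  | zero_left => simpa using continuous_const
  | zero_right => simpa using continuous_const
  | add_left x y z _ _ _ h1 h2 =>
    simp only [Pi.add_apply, map_add, inner_add_left]
    exact h1.add h2
  | add_right x y z _ _ _ h1 h2 =>
    simp only [Pi.add_apply, inner_add_right]
    exact h1.add h2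
  | smul_left r x y _ _ h =>
    simp only [Pi.smul_apply, map_smul, inner_smul_left]
    exact continuous_const.mul h
  | smul_right r x y _ _ h =>
    simp only [Pi.smul_apply, inner_smul_right]
    exact continuous_const.mul h

variable [TopologicalSpace Z]

theorem continuous_coeff_tensor [IsLCGroupoid X] [IsLCGroupoid Y] [IsTopologicalGroupoid Z]
    (π : UnitaryRep.{u, v, f} X)
    (ρ : UnitaryRep.{u', v', f'} Y) {F : Z ⥤ X} {F' : Z ⥤ Y}
    (hF : Continuous (Arrows.mapFunctor F)) (hF' : Continuous (Arrows.mapFunctor F'))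
    {σ τ : ∀ z, UniformSpace.Completion
      (π.field.fiber (F.obj z) ⊗[ℂ] ρ.field.fiber (F'.obj z))}
    (hσ : σ ∈ HilbertField.tensorSections π.field ρ.field F.obj F'.obj)
    (hτ : τ ∈ HilbertField.tensorSections π.field ρ.field F.obj F'.obj) :
    Continuous fun x : Arrows Z =>
      inner ℂ (tensorMap (π.map (F.map x.hom)) (ρ.map (F'.map x.hom)) (σ x.src)) (τ x.tgt) := by
  have hFo := continuous_obj_of_continuous_arrows hF
  have hFo' := continuous_obj_of_continuous_arrows hF'
  refine HilbertField.continuous_of_approx fun x ε hε => ?_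
  have hτn : Continuous fun z => ‖τ z‖ :=
    (π.field.tensor ρ.field hFo hFo').continuous_norm τ hτ
  set C : ℝ := ‖τ x.tgt‖ + 1 with hC
  have hC0 : 0 < C := by positivity
  obtain ⟨σ', hσ', h1⟩ := hσ x.src (ε / (2 * C)) (by positivity)
  set D : ℝ := ‖σ' x.src‖ + 1 with hD
  have hD0 : 0 < D := by positivity
  obtain ⟨τ', hτ', h2⟩ := hτ x.tgt (ε / (2 * D)) (by positivity)
  have hσn : Continuous fun z => ‖σ' z‖ := HilbertField.continuous_norm_alg hFo hFo' hσ'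
  refine ⟨fun y => inner ℂ (tensorMap (π.map (F.map y.hom)) (ρ.map (F'.map y.hom)) (σ' y.src))
    (τ' y.tgt), (continuous_coeff_alg π ρ hF hF' hσ' hτ').continuousAt, ?_⟩
  have h3 : ∀ᶠ z in 𝓝 x.tgt, ‖τ z‖ < C := hτn.continuousAt.eventually (gt_mem_nhds (by simp [hC]))
  have h4 : ∀ᶠ z in 𝓝 x.src, ‖σ' z‖ < D := hσn.continuousAt.eventually (gt_mem_nhds (by simp [hD]))
  filter_upwards [continuous_src.continuousAt.eventually h1,
    continuous_src.continuousAt.eventually h4, continuous_tgt.continuousAt.eventually h2,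
    continuous_tgt.continuousAt.eventually h3] with y h5 h6 h7 h8
  rw [dist_eq_norm]
  set U := tensorMap (π.map (F.map y.hom)) (ρ.map (F'.map y.hom))
  have e : inner ℂ (U (σ y.src)) (τ y.tgt) - inner ℂ (U (σ' y.src)) (τ' y.tgt) =
      inner ℂ (U (σ y.src - σ' y.src)) (τ y.tgt) +
        inner ℂ (U (σ' y.src)) (τ y.tgt - τ' y.tgt) := by
    rw [map_sub, inner_sub_left, inner_sub_right]
    ring
  rw [e]
  have b1 : ‖inner ℂ (U (σ y.src - σ' y.src)) (τ y.tgt)‖ ≤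
      ‖σ y.src - σ' y.src‖ * ‖τ y.tgt‖ := by
    refine (norm_inner_le_norm _ _).trans_eq ?_
    rw [U.norm_map]
  have b2 : ‖inner ℂ (U (σ' y.src)) (τ y.tgt - τ' y.tgt)‖ ≤
      ‖σ' y.src‖ * ‖τ y.tgt - τ' y.tgt‖ := by
    refine (norm_inner_le_norm _ _).trans_eq ?_
    rw [U.norm_map]
  have c1 : ‖σ y.src - σ' y.src‖ * ‖τ y.tgt‖ < ε / (2 * C) * C :=
    mul_lt_mul'' h5 h8 (norm_nonneg _) (norm_nonneg _)
  have c2 : ‖σ' y.src‖ * ‖τ y.tgt - τ' y.tgt‖ < D * (ε / (2 * D)) :=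
    mul_lt_mul'' h6 h7 (norm_nonneg _) (norm_nonneg _)
  have d1 : ε / (2 * C) * C = ε / 2 := by field_simp
  have d2 : D * (ε / (2 * D)) = ε / 2 := by field_simp
  linarith [norm_add_le (inner ℂ (U (σ y.src - σ' y.src)) (τ y.tgt))
    (inner ℂ (U (σ' y.src)) (τ y.tgt - τ' y.tgt))]

/-- For continuous groupoid homomorphisms `F : Z → X` and `F' : Z → Y`, the representation
`x ↦ π(F x) ⊗ ρ(F' x)` of `Z`. -/
@[reducible]
def tensor [IsLCGroupoid X] [IsLCGroupoid Y] [IsTopologicalGroupoid Z]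
    (π : UnitaryRep.{u, v, f} X) (ρ : UnitaryRep.{u', v', f'} Y) (F : Z ⥤ X) (F' : Z ⥤ Y)
    (hF : Continuous (Arrows.mapFunctor F)) (hF' : Continuous (Arrows.mapFunctor F')) :
    UnitaryRep.{_, _, max f f'} Z where
  field := π.field.tensor ρ.field (continuous_obj_of_continuous_arrows hF)
    (continuous_obj_of_continuous_arrows hF')
  map x := tensorMap (π.map (F.map x)) (ρ.map (F'.map x))
  map_id u h := tensorMap_id _ _ (fun k => by rw [F.map_id, π.map_id])
    (fun k => by rw [F'.map_id, ρ.map_id]) h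
  map_comp x y h := tensorMap_comp _ _ _ _ _ _ (fun k => by rw [F.map_comp, π.map_comp])
    (fun k => by rw [F'.map_comp, ρ.map_comp]) h
  map_inv x h := tensorMap_symm _ _ _ _
    (fun k => by rw [π.map_inv, Groupoid.inv_eq_inv, Groupoid.inv_eq_inv, F.map_inv])
    (fun k => by rw [ρ.map_inv, Groupoid.inv_eq_inv, Groupoid.inv_eq_inv, F'.map_inv]) h
  continuous_coeff σ hσ τ hτ := continuous_coeff_tensor π ρ hF hF' hσ.1 hτ.1

/-- The outer tensor product `π × ρ`, the representation `(x, y) ↦ π(x) ⊗ ρ(y)` of the product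
groupoid on the field `(u, v) ↦ 𝓗_u ⊗ 𝓚_v`. -/
@[reducible]
def outerTensor [IsLCGroupoid X] [IsLCGroupoid Y]
    (π : UnitaryRep.{u, v, f} X) (ρ : UnitaryRep.{u', v', f'} Y) :
    UnitaryRep.{max u u', max v v', max f f'} (X × Y) :=
  π.tensor ρ (CategoryTheory.Prod.fst X Y) (CategoryTheory.Prod.snd X Y)
    (continuous_fst.comp continuous_equivProd) (continuous_snd.comp continuous_equivProd)

/-- The inner tensor product `π ⊗ ρ`, the representation `x ↦ π(x) ⊗ ρ(x)` on the field
`u ↦ 𝓗_u ⊗ 𝓚_u`. -/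
@[reducible]
def innerTensor [IsLCGroupoid X] (π : UnitaryRep.{u, v, f} X) (ρ : UnitaryRep.{u, v, f'} X) :
    UnitaryRep.{u, v, max f f'} X :=
  π.tensor ρ (𝟭 X) (𝟭 X) continuous_id continuous_id

end UnitaryRep

end GroupoidRep

end

noncomputable section

namespace GroupoidRep

/-! ### Hilbert–Schmidt sums over orthonormal bases -/

section Basis

variable {E E' F F' : Type*} [NormedAddCommGroup E] [InnerProductSpace ℂ E]
  [NormedAddCommGroup E'] [InnerProductSpace ℂ E']
  [NormedAddCommGroup F] [InnerProductSpace ℂ F] [NormedAddCommGroup F'] [InnerProductSpace ℂ F']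
  {ι κ ι' : Type*}

/-! Both tensor products are instances of one construction: for continuous homomorphisms `F : Z ⥤ X`
and `F' : Z ⥤ Y`, the representation `z ↦ π(F z) ⊗ ρ(F' z)` of `Z`. The outer product uses the two
projections of `X × Y`, the inner one two identity functors. Apart from continuity, the only
property used is that the unit map `z ↦ (F z, F' z)` is proper.

If `T i` and `S j` witness amenability of `π` and `ρ`, the operators `T i ⊗ S j`, indexed by the
product of the directed sets, witness it for the tensor product. The localisation at `z` is the
tensor product of the localisations (`localization_tensor`). The square sum `tr |A|²` and the
Hilbert–Schmidt inner product are multiplicative on tensor products (`hsSq_tensorOp`,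
`hsInner_tensorOp`), and conjugation by `U ⊗ V` acts factorwise (`tensorMap_conj`). Norms and
coefficients are therefore products of quantities tending to 1 uniformly on the compact images of a
compact set. Properness makes the product of two trace functions vanish at infinity.

Two points need care. Hilbert–Schmidt sums are defined with a chosen basis, which on a tensor
product need not be a product basis, so basis independence is required: Tonelli for norms, then
polarisation for inner products. Moreover `T ⊗ S` must preserve `C₀` sections of the tensor field.
This follows from a uniform bound on the localisations, which holds because the operator norm is at
most the Hilbert–Schmidt norm, here at most 1.

Countable generation (`CountablyGenerated.tensor`) is witnessed by the elementary tensors of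
generators: they approximate locally, and a partition of unity makes the approximation uniform. -/

theorem _root_.HilbertBasis.hasSum_norm_inner_sq (b : HilbertBasis ι ℂ E) (x : E) :
    HasSum (fun i => ‖inner ℂ (b i) x‖ ^ 2) (‖x‖ ^ 2) := by
  have h := b.hasSum_inner_mul_inner x x
  have e : ∀ i, inner ℂ x (b i) * inner ℂ (b i) x = ((‖inner ℂ (b i) x‖ ^ 2 : ℝ) : ℂ) := fun i => by
    rw [← inner_conj_symm x (b i), RCLike.conj_mul]
    norm_cast
  have h2 : inner ℂ x x = (‖x‖ : ℂ) ^ 2 := inner_self_eq_norm_sq_to_K x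
  rw [h2] at h
  simp only [e] at h
  exact_mod_cast h

omit [InnerProductSpace ℂ E] in
theorem enorm_sq_eq_ofReal (x : E) : ‖x‖ₑ ^ 2 = ENNReal.ofReal (‖x‖ ^ 2) := by
  rw [ENNReal.ofReal_pow (norm_nonneg _), ofReal_norm]

theorem _root_.HilbertBasis.tsum_enorm_inner_sq (b : HilbertBasis ι ℂ E) (x : E) :
    ∑' i, ‖inner ℂ (b i) x‖ₑ ^ 2 = ‖x‖ₑ ^ 2 := by
  have h := b.hasSum_norm_inner_sq x
  simp only [enorm_sq_eq_ofReal]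
  rw [← ENNReal.ofReal_tsum_of_nonneg (fun _ => by positivity) h.summable, h.tsum_eq]

/-- By Parseval both sides are the double sum of `|⟨c j, A (b i)⟩|²`, taken in the two orders. In
`[0, ∞]` the interchange needs no summability. -/
theorem tsum_enorm_sq_adjoint [CompleteSpace E] [CompleteSpace E'] (b : HilbertBasis ι ℂ E)
    (c : HilbertBasis κ ℂ E') (A : E →L[ℂ] E') :
    ∑' i, ‖A (b i)‖ₑ ^ 2 = ∑' j, ‖A.adjoint (c j)‖ₑ ^ 2 := by
  simp_rw [← c.tsum_enorm_inner_sq (A _), ← b.tsum_enorm_inner_sq (A.adjoint _)]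
  rw [ENNReal.tsum_comm]
  refine tsum_congr fun j => tsum_congr fun i => ?_
  rw [ContinuousLinearMap.adjoint_inner_right, enorm_eq_nnnorm, enorm_eq_nnnorm,
    ← inner_conj_symm, RCLike.nnnorm_conj]

/-- The sum `∑ ‖A e‖²` does not depend on the orthonormal basis. -/
theorem tsum_enorm_sq_congr [CompleteSpace E] [CompleteSpace E'] (b : HilbertBasis ι ℂ E)
    (b' : HilbertBasis ι' ℂ E) (A : E →L[ℂ] E') :
    ∑' i, ‖A (b i)‖ₑ ^ 2 = ∑' i, ‖A (b' i)‖ₑ ^ 2 := by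
  -- Both sums equal the sum for the adjoint over one fixed basis of `E'`.
  rw [tsum_enorm_sq_adjoint b (stdBasis E'), tsum_enorm_sq_adjoint b' (stdBasis E')]

theorem hsSq_eq_tsum [CompleteSpace E] (b : HilbertBasis ι ℂ E) (A : E →L[ℂ] E) :
    hsSq A = ∑' i, ‖A (b i)‖ₑ ^ 2 :=
  tsum_enorm_sq_congr _ _ _

/-- Expand `A x` in the basis: each coefficient is `⟨A* e, x⟩`, to which Cauchy–Schwarz applies, and
the squares `‖A* e‖²` sum to `hsSq A`. -/
theorem enorm_apply_sq_le_hsSq [CompleteSpace E] (A : E →L[ℂ] E) (x : E) :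
    ‖A x‖ₑ ^ 2 ≤ hsSq A * ‖x‖ₑ ^ 2 := by
  rw [hsSq, tsum_enorm_sq_adjoint (stdBasis E) (stdBasis E),
    ← (stdBasis E).tsum_enorm_inner_sq (A x), ← ENNReal.tsum_mul_right]
  refine ENNReal.tsum_le_tsum fun j => ?_
  rw [← mul_pow, ← ContinuousLinearMap.adjoint_inner_left]
  gcongr
  simp only [enorm_eq_nnnorm]
  exact_mod_cast nnnorm_inner_le_nnnorm (𝕜 := ℂ) _ _

theorem norm_le_one_of_hsSq_le_one [CompleteSpace E] {A : E →L[ℂ] E} (hA : hsSq A ≤ 1) :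
    ‖A‖ ≤ 1 := by
  refine A.opNorm_le_bound zero_le_one fun x => ?_
  have h := (enorm_apply_sq_le_hsSq A x).trans (mul_le_of_le_one_left (zero_le) hA)
  rw [enorm_sq_eq_ofReal, enorm_sq_eq_ofReal, ENNReal.ofReal_le_ofReal_iff (by positivity)] at h
  rw [one_mul]
  exact (sq_le_sq₀ (norm_nonneg _) (norm_nonneg _)).1 h

omit [InnerProductSpace ℂ E] in
theorem summable_norm_sq_iff {a : ι → E} :
    Summable (fun i => ‖a i‖ ^ 2) ↔ ∑' i, ‖a i‖ₑ ^ 2 ≠ ∞ := by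
  have e : ∀ i, ‖a i‖ₑ ^ 2 = ((‖a i‖₊ ^ 2 : ℝ≥0) : ℝ≥0∞) := fun i => by
    rw [enorm_eq_nnnorm, ENNReal.coe_pow]
  simp_rw [e]
  rw [ENNReal.tsum_coe_ne_top_iff_summable, ← NNReal.summable_coe]
  simp

omit [InnerProductSpace ℂ E] in
theorem tsum_norm_sq (a : ι → E) : ∑' i, ‖a i‖ ^ 2 = (∑' i, ‖a i‖ₑ ^ 2).toReal := by
  rw [ENNReal.tsum_toReal_eq fun i => by simp]
  simp

theorem summable_norm_add_smul_sq {a b : ι → E} (ha : Summable fun i => ‖a i‖ ^ 2)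
    (hb : Summable fun i => ‖b i‖ ^ 2) (c : ℂ) : Summable fun i => ‖a i + c • b i‖ ^ 2 := by
  refine Summable.of_nonneg_of_le (fun _ => by positivity) (fun i => ?_)
    ((ha.mul_left 2).add (hb.mul_left (2 * ‖c‖ ^ 2)))
  have h := norm_add_le (a i) (c • b i)
  rw [norm_smul] at h
  have h2 : ‖a i + c • b i‖ ^ 2 ≤ (‖a i‖ + ‖c‖ * ‖b i‖) ^ 2 := by gcongr
  nlinarith [sq_nonneg (‖a i‖ - ‖c‖ * ‖b i‖)]

/-- The value is written through square sums alone, so that their independence of the basis passes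
to sums of inner products. -/
theorem hasSum_inner_polarization {a b : ι → E} (ha : Summable fun i => ‖a i‖ ^ 2)
    (hb : Summable fun i => ‖b i‖ ^ 2) :
    HasSum (fun i => inner ℂ (a i) (b i))
      (((((∑' i, ‖a i + (1 : ℂ) • b i‖ ^ 2 : ℝ) : ℂ) -
        ((∑' i, ‖a i + (-1 : ℂ) • b i‖ ^ 2 : ℝ) : ℂ)) +
        (((∑' i, ‖a i + (-Complex.I) • b i‖ ^ 2 : ℝ) : ℂ) -
          ((∑' i, ‖a i + Complex.I • b i‖ ^ 2 : ℝ) : ℂ)) * Complex.I) / 4) := by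
  have h : ∀ c : ℂ, HasSum (fun i => ((‖a i + c • b i‖ ^ 2 : ℝ) : ℂ))
      ((∑' i, ‖a i + c • b i‖ ^ 2 : ℝ) : ℂ) := fun c =>
    Complex.hasSum_ofReal.2 (summable_norm_add_smul_sq ha hb c).hasSum
  have := (((h 1).sub (h (-1))).add (((h (-Complex.I)).sub (h Complex.I)).mul_right
    Complex.I)).div_const 4
  refine this.congr_fun fun i => ?_
  rw [inner_eq_sum_norm_sq_div_four]
  simp [sub_eq_add_neg]

/-- The sum `∑ ⟨A e, B e⟩` of Hilbert–Schmidt operators does not depend on the orthonormal basis. -/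
theorem tsum_inner_congr [CompleteSpace E] [CompleteSpace E'] (b : HilbertBasis ι ℂ E)
    (b' : HilbertBasis ι' ℂ E) {A B : E →L[ℂ] E'} (hA : ∑' i, ‖A (b i)‖ₑ ^ 2 ≠ ∞)
    (hB : ∑' i, ‖B (b i)‖ₑ ^ 2 ≠ ∞) :
    ∑' i, inner ℂ (A (b i)) (B (b i)) = ∑' i, inner ℂ (A (b' i)) (B (b' i)) := by
  -- Each square sum in the polarisation formula is the Hilbert–Schmidt sum of the single operator
  -- `A + c • B`.
  have e : ∀ c : ℂ, ∑' i, ‖A (b i) + c • B (b i)‖ ^ 2 = ∑' i, ‖A (b' i) + c • B (b' i)‖ ^ 2 :=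
    fun c => by
      rw [tsum_norm_sq, tsum_norm_sq]
      exact congrArg _ (tsum_enorm_sq_congr b b' (A + c • B))
  rw [(hasSum_inner_polarization (summable_norm_sq_iff.2 hA) (summable_norm_sq_iff.2 hB)).tsum_eq]
  rw [tsum_enorm_sq_congr b b'] at hA hB
  rw [(hasSum_inner_polarization (summable_norm_sq_iff.2 hA) (summable_norm_sq_iff.2 hB)).tsum_eq]
  simp only [e]

theorem hsInner_eq_tsum [CompleteSpace E] (b : HilbertBasis ι ℂ E) {A B : E →L[ℂ] E}
    (hA : hsSq A ≠ ∞) (hB : hsSq B ≠ ∞) :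
    hsInner A B = ∑' i, inner ℂ (B (b i)) (A (b i)) :=
  tsum_inner_congr _ _ hB hA

theorem summable_norm_inner {a b : ι → E} (ha : Summable fun i => ‖a i‖ ^ 2)
    (hb : Summable fun i => ‖b i‖ ^ 2) : Summable fun i => ‖inner ℂ (a i) (b i)‖ := by
  refine Summable.of_nonneg_of_le (fun _ => norm_nonneg _) (fun i => ?_) (ha.add hb)
  have := norm_inner_le_norm (𝕜 := ℂ) (a i) (b i)
  nlinarith [sq_nonneg (‖a i‖ - ‖b i‖), sq_nonneg (‖a i‖), sq_nonneg (‖b i‖)]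

/-- The sum `∑ ‖A e‖²` is invariant under unitary conjugation. -/
theorem hsSq_conj [CompleteSpace E] [CompleteSpace E'] (U : E ≃ₗᵢ[ℂ] E') (A : E →L[ℂ] E) :
    hsSq ((U : E →L[ℂ] E') ∘L A ∘L (U.symm : E' →L[ℂ] E)) = hsSq A := by
  -- The chosen basis of `E'` pulled back along `U`; over it the two sums agree term by term.
  let b : HilbertBasis (basisSet E') ℂ E := ⟨U.trans (stdBasis E').repr⟩
  have hb : ∀ i, b i = U.symm (stdBasis E' i) := fun i => by
    classical
    rw [← b.repr_symm_single, ← (stdBasis E').repr_symm_single]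
    rfl
  rw [hsSq_eq_tsum b A, hsSq]
  refine tsum_congr fun i => ?_
  rw [hb]
  change ‖U (A (U.symm _))‖ₑ ^ 2 = _
  rw [enorm_eq_nnnorm, U.nnnorm_map, enorm_eq_nnnorm]

end Basis

/-! ### Tensor products of bounded operators -/

section TensorOp

variable {E E' F F' : Type*} [NormedAddCommGroup E] [InnerProductSpace ℂ E]
  [NormedAddCommGroup E'] [InnerProductSpace ℂ E']
  [NormedAddCommGroup F] [InnerProductSpace ℂ F] [NormedAddCommGroup F'] [InnerProductSpace ℂ F']
  {ι κ : Type*}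

/-- The right-hand factors of a tensor span a finite-dimensional subspace; expand them in an
orthonormal basis of it. In this form the norm is given by Pythagoras. -/
theorem exists_sum_tmul_orthonormal (t : E ⊗[ℂ] F) :
    ∃ (n : ℕ) (x : Fin n → E) (e : Fin n → F), Orthonormal ℂ e ∧ t = ∑ i, x i ⊗ₜ[ℂ] e i := by
  obtain ⟨k, m, y, rfl⟩ := TensorProduct.exists_sum_tmul_eq t
  let V : Submodule ℂ F := Submodule.span ℂ (Set.range y)
  have : FiniteDimensional ℂ V := FiniteDimensional.span_of_finite ℂ (Set.finite_range y)
  let e := stdOrthonormalBasis ℂ V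
  have hy : ∀ j, y j = ∑ i, inner ℂ ((e i : V) : F) (y j) • ((e i : V) : F) := fun j => by
    have h := congrArg (Subtype.val) (e.sum_repr' ⟨y j, Submodule.subset_span ⟨j, rfl⟩⟩)
    simp only [Submodule.coe_sum, Submodule.coe_smul, Submodule.coe_inner] at h
    exact h.symm
  refine ⟨_, fun i => ∑ j, inner ℂ ((e i : V) : F) (y j) • m j, fun i => ((e i : V) : F),
    e.orthonormal.comp_linearIsometry V.subtypeₗᵢ, ?_⟩
  calc ∑ j, m j ⊗ₜ[ℂ] y j
      = ∑ j, ∑ i, (inner ℂ ((e i : V) : F) (y j) • m j) ⊗ₜ[ℂ] ((e i : V) : F) := by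
        refine Finset.sum_congr rfl fun j _ => ?_
        conv_lhs => rw [hy j]
        rw [TensorProduct.tmul_sum]
        exact Finset.sum_congr rfl fun i _ => by rw [TensorProduct.tmul_smul, TensorProduct.smul_tmul']
    _ = _ := by
        rw [Finset.sum_comm]
        exact Finset.sum_congr rfl fun i _ => by rw [TensorProduct.sum_tmul]

theorem norm_sum_tmul_orthonormal_sq {n : ℕ} (x : Fin n → E) {e : Fin n → F}
    (he : Orthonormal ℂ e) : ‖∑ i, x i ⊗ₜ[ℂ] e i‖ ^ 2 = ∑ i, ‖x i‖ ^ 2 := by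
  have h : inner ℂ (∑ i, x i ⊗ₜ[ℂ] e i) (∑ i, x i ⊗ₜ[ℂ] e i) = ((∑ i, ‖x i‖ ^ 2 : ℝ) : ℂ) := by
    simp only [sum_inner, inner_sum, TensorProduct.inner_tmul, orthonormal_iff_ite.1 he]
    simp [inner_self_eq_norm_sq_to_K]
  have h2 : ((‖∑ i, x i ⊗ₜ[ℂ] e i‖ : ℝ) : ℂ) ^ 2 = ((∑ i, ‖x i‖ ^ 2 : ℝ) : ℂ) :=
    (inner_self_eq_norm_sq_to_K (𝕜 := ℂ) (∑ i, x i ⊗ₜ[ℂ] e i)).symm.trans h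
  exact_mod_cast h2

/-- With orthonormal right-hand factors, `A ⊗ id` changes only the left-hand coefficients, so the
bound holds termwise. -/
theorem norm_map_id_le (A : E →L[ℂ] E') (t : E ⊗[ℂ] F) :
    ‖TensorProduct.map (A : E →ₗ[ℂ] E') LinearMap.id t‖ ≤ ‖A‖ * ‖t‖ := by
  obtain ⟨n, x, e, he, rfl⟩ := exists_sum_tmul_orthonormal t
  refine (sq_le_sq₀ (norm_nonneg _) (by positivity)).1 ?_
  rw [mul_pow, norm_sum_tmul_orthonormal_sq x he, map_sum]
  simp only [TensorProduct.map_tmul, LinearMap.id_apply, ContinuousLinearMap.coe_coe]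
  rw [norm_sum_tmul_orthonormal_sq _ he, Finset.mul_sum]
  gcongr with i
  rw [← mul_pow]
  gcongr
  exact A.le_opNorm _

/-- `A ⊗ B` is `A ⊗ id` followed by `B ⊗ id` conjugated by the flip, and the flip is isometric. -/
theorem norm_map_le (A : E →L[ℂ] E') (B : F →L[ℂ] F') (t : E ⊗[ℂ] F) :
    ‖TensorProduct.map (A : E →ₗ[ℂ] E') (B : F →ₗ[ℂ] F') t‖ ≤ ‖A‖ * ‖B‖ * ‖t‖ := by
  have h1 : TensorProduct.map (A : E →ₗ[ℂ] E') (B : F →ₗ[ℂ] F') t =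
      TensorProduct.comm ℂ F' E' (TensorProduct.map (B : F →ₗ[ℂ] F') LinearMap.id
        (TensorProduct.comm ℂ E' F (TensorProduct.map (A : E →ₗ[ℂ] E') LinearMap.id t))) := by
    induction t with
    | zero => simp
    | tmul x y => simp
    | add s t hs ht => simp only [map_add, hs, ht]
  rw [h1, TensorProduct.norm_comm]
  refine (norm_map_id_le B _).trans ?_
  rw [TensorProduct.norm_comm, mul_comm ‖A‖, mul_assoc]
  gcongr
  exact norm_map_id_le A t

/-- The operator `A ⊗ B` between Hilbert space tensor products. -/
def tensorOp (A : E →L[ℂ] E') (B : F →L[ℂ] F') :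
    UniformSpace.Completion (E ⊗[ℂ] F) →L[ℂ] UniformSpace.Completion (E' ⊗[ℂ] F') :=
  ((UniformSpace.Completion.toComplₗᵢ (𝕜 := ℂ) (E := E' ⊗[ℂ] F')).toLinearMap ∘ₗ
    TensorProduct.map (A : E →ₗ[ℂ] E') (B : F →ₗ[ℂ] F')).extendOfNorm
    (UniformSpace.Completion.toComplₗᵢ (𝕜 := ℂ) (E := E ⊗[ℂ] F)).toLinearMap

/-- The estimate under which the extension defining `tensorOp` agrees with `A ⊗ B` on algebraic
tensors and inherits the norm bound. -/
theorem norm_compl_map_le (A : E →L[ℂ] E') (B : F →L[ℂ] F') (t : E ⊗[ℂ] F) :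
    ‖((UniformSpace.Completion.toComplₗᵢ (𝕜 := ℂ) (E := E' ⊗[ℂ] F')).toLinearMap ∘ₗ
      TensorProduct.map (A : E →ₗ[ℂ] E') (B : F →ₗ[ℂ] F')) t‖ ≤ ‖A‖ * ‖B‖ *
      ‖(UniformSpace.Completion.toComplₗᵢ (𝕜 := ℂ) (E := E ⊗[ℂ] F)).toLinearMap t‖ := by
  refine (UniformSpace.Completion.norm_coe _).trans_le ?_
  refine (norm_map_le A B t).trans_eq ?_
  exact congrArg _ (UniformSpace.Completion.norm_coe t).symm

theorem tensorOp_tmul (A : E →L[ℂ] E') (B : F →L[ℂ] F') (x : E) (y : F) :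
    tensorOp A B ((x ⊗ₜ[ℂ] y : E ⊗[ℂ] F) : UniformSpace.Completion (E ⊗[ℂ] F)) =
      ((A x ⊗ₜ[ℂ] B y : E' ⊗[ℂ] F') : UniformSpace.Completion (E' ⊗[ℂ] F')) :=
  LinearMap.extendOfNorm_eq UniformSpace.Completion.denseRange_coe
    ⟨_, norm_compl_map_le A B⟩ (x ⊗ₜ[ℂ] y)

theorem norm_tensorOp_le (A : E →L[ℂ] E') (B : F →L[ℂ] F') : ‖tensorOp A B‖ ≤ ‖A‖ * ‖B‖ :=
  LinearMap.opNorm_extendOfNorm_le UniformSpace.Completion.denseRange_coe (by positivity)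
    (norm_compl_map_le A B)

theorem inner_tensorOp [CompleteSpace E] [CompleteSpace E'] [CompleteSpace F] [CompleteSpace F']
    (A : E →L[ℂ] E') (B : F →L[ℂ] F') (s : UniformSpace.Completion (E ⊗[ℂ] F))
    (t : UniformSpace.Completion (E' ⊗[ℂ] F')) :
    inner ℂ (tensorOp A B s) t = inner ℂ s (tensorOp A.adjoint B.adjoint t) := by
  -- After passing to the adjoint, both sides are continuous linear in `t`, so elementary tensors
  -- suffice; density then reduces `s` to the same case.
  rw [← ContinuousLinearMap.adjoint_inner_right]
  congr 1
  revert t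
  rw [← DFunLike.ext_iff]
  refine tensor_ext fun x' y' => ?_
  refine ext_inner_left ℂ fun s => ?_
  rw [ContinuousLinearMap.adjoint_inner_right]
  induction s using UniformSpace.Completion.induction_on with
  | hp => exact isClosed_eq (by fun_prop) (by fun_prop)
  | ih s =>
    induction s with
    | zero => rw [UniformSpace.Completion.coe_zero, map_zero, inner_zero_left, inner_zero_left]
    | tmul x y =>
      simp only [tensorOp_tmul, UniformSpace.Completion.inner_coe, TensorProduct.inner_tmul,
        ContinuousLinearMap.adjoint_inner_right]
    | add s t hs ht =>
      rw [UniformSpace.Completion.coe_add, map_add, inner_add_left, inner_add_left, hs, ht]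

/-- The products of the vectors of two orthonormal bases are an orthonormal basis of the tensor
product. -/
theorem exists_hilbertBasis_tensor (b : HilbertBasis ι ℂ E) (c : HilbertBasis κ ℂ F) :
    ∃ B : HilbertBasis (ι × κ) ℂ (UniformSpace.Completion (E ⊗[ℂ] F)), ∀ p,
      B p = ((b p.1 ⊗ₜ[ℂ] c p.2 : E ⊗[ℂ] F) : UniformSpace.Completion (E ⊗[ℂ] F)) := by
  classical
  let g : ι × κ → UniformSpace.Completion (E ⊗[ℂ] F) := fun p =>
    ((b p.1 ⊗ₜ[ℂ] c p.2 : E ⊗[ℂ] F) : UniformSpace.Completion (E ⊗[ℂ] F))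
  have ho : Orthonormal ℂ g := by
    rw [orthonormal_iff_ite]
    rintro ⟨i, j⟩ ⟨i', j'⟩
    simp only [g, UniformSpace.Completion.inner_coe, TensorProduct.inner_tmul,
      orthonormal_iff_ite.1 b.orthonormal, orthonormal_iff_ite.1 c.orthonormal, Prod.mk.injEq]
    split_ifs <;> simp_all
  have hd : ⊤ ≤ (Submodule.span ℂ (Set.range g)).topologicalClosure := by
    set D := Submodule.span ℂ (Set.range g)
    have key : ∀ t : E ⊗[ℂ] F,
        (t : UniformSpace.Completion (E ⊗[ℂ] F)) ∈ D.topologicalClosure := by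
      intro t
      induction t with
      | zero =>
        rw [UniformSpace.Completion.coe_zero]
        exact D.topologicalClosure.zero_mem
      | add x y hx hy =>
        rw [UniformSpace.Completion.coe_add]
        exact D.topologicalClosure.add_mem hx hy
      | tmul x y =>
        have hc : Continuous fun p : E × F =>
            ((p.1 ⊗ₜ[ℂ] p.2 : E ⊗[ℂ] F) : UniformSpace.Completion (E ⊗[ℂ] F)) :=
          (UniformSpace.Completion.continuous_coe _).comp TensorProduct.continuous_tmul
        have hx : x ∈ closure (Submodule.span ℂ (Set.range b) : Set E) := by
          rw [← Submodule.topologicalClosure_coe, b.dense_span]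
          trivial
        have hy : y ∈ closure (Submodule.span ℂ (Set.range c) : Set F) := by
          rw [← Submodule.topologicalClosure_coe, c.dense_span]
          trivial
        have hxy : (x, y) ∈ closure ((Submodule.span ℂ (Set.range b) : Set E) ×ˢ
            (Submodule.span ℂ (Set.range c) : Set F)) := by
          rw [closure_prod_eq]
          exact ⟨hx, hy⟩
        -- Joint continuity of `⊗` reduces the claim to vectors in the algebraic spans of the two
        -- bases.
        refine map_mem_closure (f := fun p : E × F =>
          ((p.1 ⊗ₜ[ℂ] p.2 : E ⊗[ℂ] F) : UniformSpace.Completion (E ⊗[ℂ] F))) hc hxy ?_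
        rintro ⟨x, y⟩ ⟨hx, hy⟩
        simp only [SetLike.mem_coe] at hx hy ⊢
        induction hx, hy using Submodule.span_induction₂ with
        | mem_mem x y h h' =>
          obtain ⟨i, rfl⟩ := h
          obtain ⟨j, rfl⟩ := h'
          exact Submodule.subset_span ⟨(i, j), rfl⟩
        | zero_left =>
          rw [TensorProduct.zero_tmul, UniformSpace.Completion.coe_zero]
          exact D.zero_mem
        | zero_right =>
          rw [TensorProduct.tmul_zero, UniformSpace.Completion.coe_zero]
          exact D.zero_mem
        | add_left x y z _ _ _ h1 h2 =>
          rw [TensorProduct.add_tmul, UniformSpace.Completion.coe_add]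
          exact D.add_mem h1 h2
        | add_right x y z _ _ _ h1 h2 =>
          rw [TensorProduct.tmul_add, UniformSpace.Completion.coe_add]
          exact D.add_mem h1 h2
        | smul_left r x y _ _ h =>
          rw [← TensorProduct.smul_tmul', UniformSpace.Completion.coe_smul]
          exact D.smul_mem _ h
        | smul_right r x y _ _ h =>
          rw [TensorProduct.tmul_smul, UniformSpace.Completion.coe_smul]
          exact D.smul_mem _ h
    intro z _
    refine UniformSpace.Completion.induction_on z ?_ key
    exact D.isClosed_topologicalClosure
  exact ⟨HilbertBasis.mk ho hd, fun p => congrFun (HilbertBasis.coe_mk ho hd) p⟩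

/-! ### Multiplicativity of Hilbert–Schmidt norms and inner products -/

variable [CompleteSpace E] [CompleteSpace F]

/-- Over a product basis the terms factor, and so does the double sum in `[0, ∞]`, without any
finiteness assumption. -/
theorem hsSq_tensorOp (A : E →L[ℂ] E) (B : F →L[ℂ] F) :
    hsSq (tensorOp A B) = hsSq A * hsSq B := by
  obtain ⟨C, hC⟩ := exists_hilbertBasis_tensor (stdBasis E) (stdBasis F)
  rw [hsSq_eq_tsum C, ENNReal.tsum_prod', hsSq, hsSq, ← ENNReal.tsum_mul_right]
  refine tsum_congr fun i => ?_
  rw [← ENNReal.tsum_mul_left]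
  refine tsum_congr fun j => ?_
  rw [hC, tensorOp_tmul, ← mul_pow, enorm_eq_nnnorm, UniformSpace.Completion.nnnorm_coe,
    ← enorm_eq_nnnorm, TensorProduct.enorm_tmul]

theorem hsNorm_tensorOp (A : E →L[ℂ] E) (B : F →L[ℂ] F) :
    hsNorm (tensorOp A B) = hsNorm A * hsNorm B := by
  rw [hsNorm, hsSq_tensorOp, ENNReal.mul_rpow_of_nonneg _ _ (by norm_num)]
  rfl

/-- Finiteness enters twice: to change to a product basis, and to make both series absolutely
convergent so that their product is the double series. -/
theorem hsInner_tensorOp {A A' : E →L[ℂ] E} {B B' : F →L[ℂ] F} (hA : hsSq A ≠ ∞)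
    (hA' : hsSq A' ≠ ∞) (hB : hsSq B ≠ ∞) (hB' : hsSq B' ≠ ∞) :
    hsInner (tensorOp A B) (tensorOp A' B') = hsInner A A' * hsInner B B' := by
  obtain ⟨C, hC⟩ := exists_hilbertBasis_tensor (stdBasis E) (stdBasis F)
  rw [hsInner_eq_tsum C (by rw [hsSq_tensorOp]; exact ENNReal.mul_ne_top hA hB)
    (by rw [hsSq_tensorOp]; exact ENNReal.mul_ne_top hA' hB'), hsInner, hsInner,
    tsum_mul_tsum_of_summable_norm
      (summable_norm_inner (summable_norm_sq_iff.2 hA') (summable_norm_sq_iff.2 hA))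
      (summable_norm_inner (summable_norm_sq_iff.2 hB') (summable_norm_sq_iff.2 hB))]
  refine tsum_congr fun p => ?_
  rw [hC, tensorOp_tmul, tensorOp_tmul, UniformSpace.Completion.inner_coe,
    TensorProduct.inner_tmul]

-- This identifies the action of an arrow on `A ⊗ B` with the tensor product of its actions on `A`
-- and `B`.
omit [CompleteSpace E] [CompleteSpace F] in
theorem tensorMap_conj (U : E ≃ₗᵢ[ℂ] E') (V : F ≃ₗᵢ[ℂ] F')
    (A : E →L[ℂ] E) (B : F →L[ℂ] F) :
    (tensorMap U V : UniformSpace.Completion (E ⊗[ℂ] F) →L[ℂ]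
        UniformSpace.Completion (E' ⊗[ℂ] F')) ∘L tensorOp A B ∘L
      ((tensorMap U V).symm : UniformSpace.Completion (E' ⊗[ℂ] F') →L[ℂ]
        UniformSpace.Completion (E ⊗[ℂ] F)) =
      tensorOp ((U : E →L[ℂ] E') ∘L A ∘L (U.symm : E' →L[ℂ] E))
        ((V : F →L[ℂ] F') ∘L B ∘L (V.symm : F' →L[ℂ] F)) := by
  refine tensor_ext fun x y => ?_
  rw [tensorOp_tmul]
  change tensorMap U V (tensorOp A B ((tensorMap U V).symm _)) = _
  rw [tensorMap_symm U V U.symm V.symm (fun _ => rfl) (fun _ => rfl), tensorMap_tmul,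
    tensorOp_tmul, tensorMap_tmul]
  rfl

end TensorOp

/-! ### Tensor products of adjointable operators -/

namespace AdjointableOp

variable {X : Type u} [TopologicalSpace X] {𝓗 : HilbertField.{u, f} X}

/-- The adjoint of an adjointable operator. -/
def adj (T : AdjointableOp 𝓗) : AdjointableOp 𝓗 where
  toFun := T.exists_adjoint.choose
  exists_adjoint := ⟨T.toFun, fun ξ η u => by
    rw [← inner_conj_symm, ← T.exists_adjoint.choose_spec, inner_conj_symm]⟩

variable [T2Space X] [LocallyCompactSpace X]

/-- Sections in `C₀` take every value in a fibre, so the adjoint relation of the module, read at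
`u`, determines the adjoint of the fibre operator. -/
theorem localization_adj (T : AdjointableOp 𝓗) (u : X) :
    T.adj.localization u = (T.localization u).adjoint := by
  refine ContinuousLinearMap.ext fun k => ext_inner_left ℂ fun h => ?_
  obtain ⟨ξ, hξ, rfl⟩ := HilbertField.exists_mem_C0_eq u h
  obtain ⟨η, hη, rfl⟩ := HilbertField.exists_mem_C0_eq u k
  rw [ContinuousLinearMap.adjoint_inner_right, T.adj.localization_apply u ⟨η, hη⟩,
    T.localization_apply u ⟨ξ, hξ⟩]
  exact (T.exists_adjoint.choose_spec ⟨ξ, hξ⟩ ⟨η, hη⟩ u).symm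

theorem norm_localization_adj (T : AdjointableOp 𝓗) (u : X) :
    ‖T.adj.localization u‖ = ‖T.localization u‖ := by
  rw [localization_adj, LinearIsometryEquiv.norm_map]

/-- Sections of the tensor field are built from all of `Γ`, whereas `T` acts on `C₀` only. Near each
point a continuous section coincides with one in `C₀`, and membership in `Γ` is local. -/
theorem localization_mem_Γ (T : AdjointableOp 𝓗) {ξ : ∀ u, 𝓗.fiber u} (hξ : ξ ∈ 𝓗.Γ) :
    (fun u => T.localization u (ξ u)) ∈ 𝓗.Γ := by
  refine 𝓗.mem_of_locally_approx _ fun u ε hε => ?_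
  obtain ⟨ζ, hζ, h⟩ := HilbertField.exists_mem_C0_eventuallyEq hξ u
  refine ⟨(T.toFun ⟨ζ, hζ⟩).1, (T.toFun ⟨ζ, hζ⟩).2.1, ?_⟩
  filter_upwards [h] with s hs
  rw [← T.localization_apply s ⟨ζ, hζ⟩, ← hs]
  simpa using hε

variable {Y : Type u'} {Z : Type*} [TopologicalSpace Y] [T2Space Y] [LocallyCompactSpace Y]
  [TopologicalSpace Z] {𝓚 : HilbertField.{u', f'} Y} {a : Z → X} {b : Z → Y}

omit [TopologicalSpace Z] in
theorem tensorOp_mem_alg (T : AdjointableOp 𝓗) (S : AdjointableOp 𝓚)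
    {σ : ∀ z, UniformSpace.Completion (𝓗.fiber (a z) ⊗[ℂ] 𝓚.fiber (b z))}
    (hσ : σ ∈ HilbertField.algTensorSections 𝓗 𝓚 a b) :
    (fun z => tensorOp (T.localization (a z)) (S.localization (b z)) (σ z)) ∈
      HilbertField.algTensorSections 𝓗 𝓚 a b := by
  induction hσ using Submodule.span_induction with
  | mem σ h =>
    obtain ⟨ξ, hξ, η, hη, rfl⟩ := h
    refine Submodule.subset_span ⟨_, T.localization_mem_Γ hξ, _, S.localization_mem_Γ hη, ?_⟩
    funext z
    exact tensorOp_tmul _ _ _ _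
  | zero =>
    simp only [Pi.zero_apply, map_zero]
    exact Submodule.zero_mem _
  | add σ τ _ _ h1 h2 =>
    simp only [Pi.add_apply, map_add]
    exact Submodule.add_mem _ h1 h2
  | smul c σ _ h =>
    simp only [Pi.smul_apply, map_smul]
    exact Submodule.smul_mem _ c h

omit [T2Space X] [LocallyCompactSpace X] [T2Space Y] [LocallyCompactSpace Y] in
theorem norm_tensorOp_localization_le {T : AdjointableOp 𝓗} {S : AdjointableOp 𝓚}
    (hT : ∀ u, ‖T.localization u‖ ≤ 1) (hS : ∀ v, ‖S.localization v‖ ≤ 1) (u : X) (v : Y)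
    (h : UniformSpace.Completion (𝓗.fiber u ⊗[ℂ] 𝓚.fiber v)) :
    ‖tensorOp (T.localization u) (S.localization v) h‖ ≤ ‖h‖ := by
  refine ContinuousLinearMap.le_of_opNorm_le_of_le _ ?_ le_rfl |>.trans_eq (one_mul _)
  exact (norm_tensorOp_le _ _).trans (mul_le_one₀ (hT u) (norm_nonneg _) (hS v))

/-- Local approximants by algebraic sections are mapped to such approximants, because the fibre
operators are contractions and do not enlarge the error; the same bound preserves vanishing at
infinity. -/
theorem tensorOp_mem_C0 (ha : Continuous a) (hb : Continuous b)
    {T : AdjointableOp 𝓗} {S : AdjointableOp 𝓚}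
    (hT : ∀ u, ‖T.localization u‖ ≤ 1) (hS : ∀ v, ‖S.localization v‖ ≤ 1)
    {σ : ∀ z, UniformSpace.Completion (𝓗.fiber (a z) ⊗[ℂ] 𝓚.fiber (b z))}
    (hσ : σ ∈ (𝓗.tensor 𝓚 ha hb).C0) :
    (fun z => tensorOp (T.localization (a z)) (S.localization (b z)) (σ z)) ∈
      (𝓗.tensor 𝓚 ha hb).C0 := by
  refine ⟨fun z ε hε => ?_, squeeze_zero (fun _ => norm_nonneg _)
    (fun z => norm_tensorOp_localization_le hT hS _ _ _) hσ.2⟩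
  obtain ⟨τ, hτ, h⟩ := hσ.1 z ε hε
  refine ⟨_, tensorOp_mem_alg T S hτ, ?_⟩
  filter_upwards [h] with s hs
  rw [← map_sub]
  exact (norm_tensorOp_localization_le hT hS _ _ _).trans_lt hs

/-- The tensor product of two adjointable contractions. -/
def tensor (ha : Continuous a) (hb : Continuous b) (T : AdjointableOp 𝓗) (S : AdjointableOp 𝓚)
    (hT : ∀ u, ‖T.localization u‖ ≤ 1) (hS : ∀ v, ‖S.localization v‖ ≤ 1) :
    AdjointableOp (𝓗.tensor 𝓚 ha hb) where
  toFun σ := ⟨_, tensorOp_mem_C0 ha hb hT hS σ.2⟩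
  -- The adjoint is the tensor product of the adjoints, which are again fibrewise contractions.
  exists_adjoint := ⟨fun σ => ⟨_, tensorOp_mem_C0 ha hb (T := T.adj) (S := S.adj)
    (fun u => (T.norm_localization_adj u).trans_le (hT u))
    (fun v => (S.norm_localization_adj v).trans_le (hS v)) σ.2⟩, fun σ τ z => by
      refine (inner_tensorOp _ _ _ _).trans ?_
      rw [← localization_adj, ← localization_adj]⟩

theorem localization_tensor [T2Space Z] [LocallyCompactSpace Z] (ha : Continuous a)
    (hb : Continuous b) (T : AdjointableOp 𝓗) (S : AdjointableOp 𝓚)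
    (hT : ∀ u, ‖T.localization u‖ ≤ 1) (hS : ∀ v, ‖S.localization v‖ ≤ 1) (z : Z) :
    (T.tensor ha hb S hT hS).localization z =
      tensorOp (T.localization (a z)) (S.localization (b z)) := by
  refine ContinuousLinearMap.ext fun h => ?_
  obtain ⟨σ, hσ, rfl⟩ := HilbertField.exists_mem_C0_eq (𝓗 := 𝓗.tensor 𝓚 ha hb) z h
  exact (T.tensor ha hb S hT hS).localization_apply z ⟨σ, hσ⟩

omit [T2Space X] [LocallyCompactSpace X] in
theorem hsSq_localization_le_one {T : AdjointableOp 𝓗} (hT : T.moduleHSNorm ≤ 1) (u : X) :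
    hsSq (T.localization u) ≤ 1 := by
  have h : hsNorm (T.localization u) ≤ 1 :=
    (le_iSup (fun u => hsNorm (T.localization u)) u).trans hT
  rw [hsNorm, ← ENNReal.one_rpow (1 / 2)] at h
  exact (ENNReal.rpow_le_rpow_iff (by norm_num)).1 h

omit [T2Space X] [LocallyCompactSpace X] in
theorem norm_localization_le_one {T : AdjointableOp 𝓗} (hT : T.moduleHSNorm ≤ 1) (u : X) :
    ‖T.localization u‖ ≤ 1 :=
  norm_le_one_of_hsSq_le_one (hsSq_localization_le_one hT u)

end AdjointableOp

/-! ### Countable generation of tensor products -/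

namespace HilbertField

/-! ### From local to uniform approximation by the span of a set of sections -/

section Module

variable {Z : Type*} [TopologicalSpace Z] (𝓛 : HilbertField Z) (S : Set (∀ z, 𝓛.fiber z))

/-- The `C₀(Z)`-linear span of a set of sections. -/
def C0Span : Submodule ℂ (∀ z, 𝓛.fiber z) :=
  Submodule.span ℂ {σ | ∃ f : C₀(Z, ℂ), ∃ s ∈ S, σ = fun z => f z • s z}

variable {𝓛 S}

/-- The complex scalars are absorbed into the coefficient functions, which gives the form required
by `CountablyGenerated`. -/
theorem exists_sum_of_mem_C0Span {σ : ∀ z, 𝓛.fiber z} (hσ : σ ∈ 𝓛.C0Span S) :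
    ∃ (n : ℕ) (f : Fin n → C₀(Z, ℂ)) (s : Fin n → S), ∀ z, σ z = ∑ i, f i z • (s i).1 z := by
  obtain ⟨n, c, g, rfl⟩ := Submodule.mem_span_set'.1 hσ
  choose f s hs hg using fun i => (g i).2
  refine ⟨n, fun i => c i • f i, fun i => ⟨s i, hs i⟩, fun z => ?_⟩
  rw [Finset.sum_apply]
  refine Finset.sum_congr rfl fun i _ => ?_
  rw [Pi.smul_apply, hg i, ZeroAtInftyContinuousMap.smul_apply, smul_assoc]

/-- A continuous function of compact support as an element of `C₀`. -/
def zeroAtInftyOfCompactSupport (φ : Z → ℂ) (hφ : Continuous φ) (h : HasCompactSupport φ) :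
    C₀(Z, ℂ) where
  toFun := φ
  continuous_toFun := hφ
  zero_at_infty' := h.is_zero_at_infty

theorem smul_mem_C0Span {φ : Z → ℂ} (hφ : Continuous φ) (hc : HasCompactSupport φ)
    {σ : ∀ z, 𝓛.fiber z} (hσ : σ ∈ 𝓛.C0Span S) : (fun z => φ z • σ z) ∈ 𝓛.C0Span S := by
  induction hσ using Submodule.span_induction with
  | mem σ h =>
    obtain ⟨f, s, hs, rfl⟩ := h
    refine Submodule.subset_span ⟨zeroAtInftyOfCompactSupport (fun z => φ z * f z)
      (hφ.mul f.continuous) hc.mul_right, s, hs, ?_⟩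
    funext z
    exact smul_smul _ _ _
  | zero =>
    simp only [Pi.zero_apply, smul_zero]
    exact Submodule.zero_mem _
  | add σ τ _ _ h1 h2 =>
    simp only [Pi.add_apply, smul_add]
    exact Submodule.add_mem _ h1 h2
  | smul c σ _ h =>
    simp only [Pi.smul_apply, smul_comm _ c]
    exact Submodule.smul_mem _ c h

/-- If locally every continuous section can be approximated from the `C₀(Z)`-linear span of `S`,
then so can every section vanishing at infinity, uniformly. -/
theorem exists_mem_C0Span_approx [T2Space Z] [LocallyCompactSpace Z] {σ : ∀ z, 𝓛.fiber z}
    (hσ : σ ∈ 𝓛.C0)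
    (h : ∀ z, ∀ ε > (0 : ℝ), ∃ τ ∈ 𝓛.C0Span S, ∀ᶠ s in 𝓝 z, ‖σ s - τ s‖ < ε)
    {ε : ℝ} (hε : 0 < ε) : ∃ τ ∈ 𝓛.C0Span S, ∀ z, ‖σ z - τ z‖ < ε := by
  have h2 : 0 < ε / 2 := half_pos hε
  -- Outside `K` the section is already below `ε / 2`, so only `K` has to be covered by
  -- approximants.
  obtain ⟨K, hK, hσK⟩ := mem_cocompact.1 (hσ.2.eventually (gt_mem_nhds h2))
  choose τ hτ hU using fun z => h z (ε / 2) h2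
  have hV : ∀ z, ∃ V : Set Z, (∀ s ∈ V, ‖σ s - τ z s‖ < ε / 2) ∧ IsOpen V ∧ z ∈ V := fun z =>
    eventually_nhds_iff.1 (hU z)
  choose V hV hVo hzV using hV
  obtain ⟨t, ht⟩ := hK.elim_finite_subcover V hVo fun z _ => Set.mem_iUnion.2 ⟨z, hzV z⟩
  obtain ⟨p, hpV, hpc⟩ := PartitionOfUnity.exists_isSubordinate_of_locallyFinite_t2space hK
    (fun i : t => V i) (fun i => hVo i) (locallyFinite_of_finite _)
    (by simpa [Set.iUnion_subtype] using ht)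
  refine ⟨∑ i : t, fun z => (p i z : ℂ) • τ i z, Submodule.sum_mem _ fun i _ =>
    smul_mem_C0Span (Complex.continuous_ofReal.comp (p i).continuous)
      ((hpc i).comp_left Complex.ofReal_zero) (hτ i), fun z => ?_⟩
  have h1 : ∑ i : t, p i z ≤ 1 := by
    rw [← finsum_eq_sum_of_fintype]
    exact p.sum_le_one z
  -- The first term of the error vanishes on `K`, where the partition sums to 1, and has small `σ z`
  -- elsewhere; the second averages local errors. Together they are at most `ε / 2`, the weights
  -- adding up to 1.
  have e : σ z - (∑ i : t, fun z => (p i z : ℂ) • τ i z) z =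
      ((1 - ∑ i : t, p i z : ℝ) : ℂ) • σ z + ∑ i : t, (p i z : ℂ) • (σ z - τ i z) := by
    simp only [Finset.sum_apply, smul_sub, Finset.sum_sub_distrib, ← Finset.sum_smul]
    push_cast
    rw [sub_smul, one_smul]
    abel
  have b1 : ‖((1 - ∑ i : t, p i z : ℝ) : ℂ) • σ z‖ ≤ (1 - ∑ i : t, p i z) * (ε / 2) := by
    rw [norm_smul, Complex.norm_real, Real.norm_of_nonneg (sub_nonneg.2 h1)]
    by_cases hz : z ∈ K
    · have := p.sum_eq_one hz
      rw [finsum_eq_sum_of_fintype] at this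
      rw [this, sub_self, zero_mul, zero_mul]
    · exact mul_le_mul_of_nonneg_left (hσK hz).le (sub_nonneg.2 h1)
  have b2 : ‖∑ i : t, (p i z : ℂ) • (σ z - τ i z)‖ ≤ (∑ i : t, p i z) * (ε / 2) := by
    rw [Finset.sum_mul]
    refine norm_sum_le_of_le _ fun i _ => ?_
    rw [norm_smul, Complex.norm_real, Real.norm_of_nonneg (p.nonneg i z)]
    by_cases hz : z ∈ tsupport (p i)
    · exact mul_le_mul_of_nonneg_left (hV i z (hpV i hz)).le (p.nonneg i z)
    · simp [image_eq_zero_of_notMem_tsupport hz]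
  rw [e]
  have := norm_add_le (((1 - ∑ i : t, p i z : ℝ) : ℂ) • σ z)
    (∑ i : t, (p i z : ℂ) • (σ z - τ i z))
  nlinarith

theorem exists_approx_of_generating [T2Space Z] [LocallyCompactSpace Z]
    (hS : ∀ ξ ∈ 𝓛.C0, ∀ ε > (0 : ℝ), ∃ (n : ℕ) (f : Fin n → C₀(Z, ℂ)) (s : Fin n → S),
      ∀ u, ‖ξ u - ∑ i, f i u • (s i).1 u‖ < ε)
    {ξ : ∀ u, 𝓛.fiber u} (hξ : ξ ∈ 𝓛.Γ) (z : Z) {ε : ℝ} (hε : 0 < ε) :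
    ∃ (n : ℕ) (f : Fin n → C₀(Z, ℂ)) (s : Fin n → S),
      ∀ᶠ u in 𝓝 z, ‖ξ u - ∑ i, f i u • (s i).1 u‖ < ε := by
  obtain ⟨ζ, hζ, h⟩ := exists_mem_C0_eventuallyEq hξ z
  obtain ⟨n, f, s, hs⟩ := hS ζ hζ ε hε
  refine ⟨n, f, s, ?_⟩
  filter_upwards [h] with u hu
  rw [← hu]
  exact hs u

end Module

/-! ### Elementary tensors of generators -/

variable {X : Type u} {Y : Type u'} {Z : Type*} [TopologicalSpace X] [TopologicalSpace Y]
  [TopologicalSpace Z] {𝓗 : HilbertField.{u, f} X} {𝓚 : HilbertField.{u', f'} Y}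
  {a : Z → X} {b : Z → Y}

/-- The cutoff `φ` makes the coefficients `φ · (f ∘ a) · (g ∘ b)` compactly supported, whatever the
behaviour of `a` and `b` at infinity. -/
theorem smul_pureSection_mem_C0Span (ha : Continuous a) (hb : Continuous b)
    {S₁ : Set (∀ u, 𝓗.fiber u)} {S₂ : Set (∀ v, 𝓚.fiber v)} {φ : Z → ℂ} (hφ : Continuous φ)
    (hc : HasCompactSupport φ) {n m : ℕ} (f : Fin n → C₀(X, ℂ)) (s : Fin n → S₁)
    (g : Fin m → C₀(Y, ℂ)) (t : Fin m → S₂) :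
    (fun z => φ z • pureSection 𝓗 𝓚 a b (fun u => ∑ i, f i u • (s i).1 u)
      (fun v => ∑ j, g j v • (t j).1 v) z) ∈
      (𝓗.tensor 𝓚 ha hb).C0Span (Set.image2 (pureSection 𝓗 𝓚 a b) S₁ S₂) := by
  have e : (fun z => φ z • pureSection 𝓗 𝓚 a b (fun u => ∑ i, f i u • (s i).1 u)
      (fun v => ∑ j, g j v • (t j).1 v) z) = ∑ i, ∑ j, fun z =>
      (φ z * (f i (a z) * g j (b z))) • pureSection 𝓗 𝓚 a b (s i).1 (t j).1 z := by
    funext z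
    simp only [pureSection, Finset.sum_apply, TensorProduct.sum_tmul, TensorProduct.tmul_sum,
      TensorProduct.tmul_smul, ← TensorProduct.smul_tmul']
    have : ∀ t : 𝓗.fiber (a z) ⊗[ℂ] 𝓚.fiber (b z), (t :
        UniformSpace.Completion (𝓗.fiber (a z) ⊗[ℂ] 𝓚.fiber (b z))) =
        UniformSpace.Completion.toComplₗᵢ (𝕜 := ℂ) t := fun _ => rfl
    simp only [this, map_sum, map_smul, Finset.smul_sum, smul_smul]
    rw [Finset.sum_comm]
    simp only [mul_comm (f _ _)]
  rw [e]
  refine Submodule.sum_mem _ fun i _ => Submodule.sum_mem _ fun j _ => Submodule.subset_span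
    ⟨zeroAtInftyOfCompactSupport (fun z => φ z * (f i (a z) * g j (b z))) ?_ hc.mul_right,
      _, ⟨_, (s i).2, _, (t j).2, rfl⟩, rfl⟩
  exact hφ.mul (((f i).continuous.comp ha).mul ((g j).continuous.comp hb))

omit [TopologicalSpace Z] in
theorem norm_pureSection (ξ : ∀ u, 𝓗.fiber u) (η : ∀ v, 𝓚.fiber v) (z : Z) :
    ‖pureSection 𝓗 𝓚 a b ξ η z‖ = ‖ξ (a z)‖ * ‖η (b z)‖ := by
  rw [pureSection, UniformSpace.Completion.norm_coe, TensorProduct.norm_tmul]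

omit [TopologicalSpace Z] in
theorem norm_pureSection_sub_le (ξ ξ' : ∀ u, 𝓗.fiber u) (η η' : ∀ v, 𝓚.fiber v) (z : Z) :
    ‖pureSection 𝓗 𝓚 a b ξ η z - pureSection 𝓗 𝓚 a b ξ' η' z‖ ≤
      ‖ξ (a z) - ξ' (a z)‖ * ‖η (b z)‖ + ‖ξ' (a z)‖ * ‖η (b z) - η' (b z)‖ := by
  have e : pureSection 𝓗 𝓚 a b ξ η z - pureSection 𝓗 𝓚 a b ξ' η' z =
      pureSection 𝓗 𝓚 a b (ξ - ξ') η z + pureSection 𝓗 𝓚 a b ξ' (η - η') z := by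
    simp only [pureSection, ← UniformSpace.Completion.coe_sub, ← UniformSpace.Completion.coe_add,
      Pi.sub_apply, TensorProduct.sub_tmul, TensorProduct.tmul_sub]
    congr 1
    abel
  rw [e]
  refine (norm_add_le _ _).trans_eq ?_
  rw [norm_pureSection, norm_pureSection]
  rfl

/-- The function `(u, v) ↦ ‖ξ u‖ ‖η v‖` vanishes at infinity on `X × Y`, and pulling back along the
proper map `(a, b)` preserves this. -/
theorem pureSection_mem_C0 (ha : Continuous a) (hb : Continuous b)
    (hab : Tendsto (fun z => (a z, b z)) (cocompact Z) (cocompact (X × Y)))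
    {ξ : ∀ u, 𝓗.fiber u} {η : ∀ v, 𝓚.fiber v} (hξ : ξ ∈ 𝓗.C0) (hη : η ∈ 𝓚.C0) :
    pureSection 𝓗 𝓚 a b ξ η ∈ (𝓗.tensor 𝓚 ha hb).C0 := by
  refine ⟨algTensorSections_le (Submodule.subset_span ⟨ξ, hξ.1, η, hη.1, rfl⟩), ?_⟩
  have := (tendsto_mul_cocompact_nhds_zero (𝓗.continuous_norm ξ hξ.1) (𝓚.continuous_norm η hη.1)
    hξ.2 hη.2).comp hab
  refine this.congr fun z => ?_
  rw [norm_pureSection]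
  rfl

variable [T2Space X] [LocallyCompactSpace X] [T2Space Y] [LocallyCompactSpace Y] [T2Space Z]
  [LocallyCompactSpace Z]

theorem CountablyGenerated.tensor (h₁ : 𝓗.CountablyGenerated) (h₂ : 𝓚.CountablyGenerated)
    (ha : Continuous a) (hb : Continuous b)
    (hab : Tendsto (fun z => (a z, b z)) (cocompact Z) (cocompact (X × Y))) :
    (𝓗.tensor 𝓚 ha hb).CountablyGenerated := by
  obtain ⟨S₁, hS₁c, hS₁, hS₁g⟩ := h₁
  obtain ⟨S₂, hS₂c, hS₂, hS₂g⟩ := h₂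
  refine ⟨Set.image2 (pureSection 𝓗 𝓚 a b) S₁ S₂, hS₁c.image2 hS₂c _, ?_, ?_⟩
  · rintro _ ⟨s, hs, t, ht, rfl⟩
    exact pureSection_mem_C0 ha hb hab (hS₁ hs) (hS₂ ht)
  set N := (𝓗.tensor 𝓚 ha hb).C0Span (Set.image2 (pureSection 𝓗 𝓚 a b) S₁ S₂) with hN
  have alg : ∀ σ ∈ algTensorSections 𝓗 𝓚 a b, ∀ z, ∀ ε > (0 : ℝ), ∃ τ ∈ N,
      ∀ᶠ s in 𝓝 z, ‖σ s - τ s‖ < ε := by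
    intro σ hσ z
    induction hσ using Submodule.span_induction with
    | mem σ h =>
      intro ε hε
      obtain ⟨ξ, hξ, η, hη, rfl⟩ := h
      have hηb := ((𝓚.continuous_norm η hη).comp hb).continuousAt.eventually
        (gt_mem_nhds (lt_add_one ‖η (b z)‖))
      set D : ℝ := ‖η (b z)‖ + 1
      have hD : 0 < D := by positivity
      -- The order of choices matters: `D` bounds `η` near `b z` and fixes the accuracy for `ξ`;
      -- only then is the approximant `ξ'` known, whose local bound `C` fixes the accuracy for `η`.
      obtain ⟨n, f, s, hfs⟩ := exists_approx_of_generating hS₁g hξ (a z)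
        (ε := ε / (2 * D)) (by positivity)
      set ξ' : ∀ u, 𝓗.fiber u := fun u => ∑ i, f i u • (s i).1 u
      have hξ' : ξ' ∈ 𝓗.Γ := by
        have : ξ' = ∑ i, fun u => f i u • (s i).1 u := by
          funext u
          simp [ξ']
        rw [this]
        exact Submodule.sum_mem _ fun i _ => smul_mem_Γ (f i).continuous (hS₁ (s i).2).1
      have hξb := ((𝓗.continuous_norm ξ' hξ').comp ha).continuousAt.eventually
        (gt_mem_nhds (lt_add_one ‖ξ' (a z)‖))
      set C : ℝ := ‖ξ' (a z)‖ + 1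
      have hC : 0 < C := by positivity
      obtain ⟨m, g, t, hgt⟩ := exists_approx_of_generating hS₂g hη (b z)
        (ε := ε / (2 * C)) (by positivity)
      -- A cutoff equal to 1 near `z` puts the approximant in the span without changing it there.
      obtain ⟨K, hK, hKz⟩ := exists_compact_mem_nhds z
      obtain ⟨φ, hφ1, -, hφc, -⟩ := exists_continuous_one_zero_of_isCompact hK isClosed_empty
        (Set.disjoint_empty K)
      refine ⟨_, smul_pureSection_mem_C0Span ha hb
        (Complex.continuous_ofReal.comp φ.continuous) (hφc.comp_left Complex.ofReal_zero) f s g t,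
        ?_⟩
      filter_upwards [hηb, hξb, ha.continuousAt.eventually hfs, hb.continuousAt.eventually hgt,
        hKz] with y h1 h2 h3 h4 h5
      have h6 : φ y = 1 := hφ1 h5
      simp only [Function.comp_apply, h6, Complex.ofReal_one, one_smul]
      refine (norm_pureSection_sub_le _ _ _ _ _).trans_lt ?_
      have c1 : ‖ξ (a y) - ξ' (a y)‖ * ‖η (b y)‖ < ε / (2 * D) * D :=
        mul_lt_mul'' h3 h1 (norm_nonneg _) (norm_nonneg _)
      have c2 : ‖ξ' (a y)‖ * ‖η (b y) - ∑ j, g j (b y) • (t j).1 (b y)‖ < C * (ε / (2 * C)) :=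
        mul_lt_mul'' h2 h4 (norm_nonneg _) (norm_nonneg _)
      have d1 : ε / (2 * D) * D = ε / 2 := by field_simp
      have d2 : C * (ε / (2 * C)) = ε / 2 := by field_simp
      linarith
    | zero => exact fun ε hε => ⟨0, N.zero_mem, by simp [hε]⟩
    | add σ σ' _ _ h h' =>
      intro ε hε
      obtain ⟨τ, hτ, h1⟩ := h (ε / 2) (half_pos hε)
      obtain ⟨τ', hτ', h2⟩ := h' (ε / 2) (half_pos hε)
      refine ⟨τ + τ', N.add_mem hτ hτ', ?_⟩
      filter_upwards [h1, h2] with s h3 h4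
      rw [Pi.add_apply, Pi.add_apply, add_sub_add_comm]
      linarith [norm_add_le (σ s - τ s) (σ' s - τ' s)]
    | smul c σ _ h =>
      intro ε hε
      obtain ⟨τ, hτ, h1⟩ := h (ε / (‖c‖ + 1)) (by positivity)
      refine ⟨c • τ, N.smul_mem c hτ, ?_⟩
      filter_upwards [h1] with s h2
      rw [Pi.smul_apply, Pi.smul_apply, ← smul_sub, norm_smul]
      rw [lt_div_iff₀ (by positivity)] at h2
      nlinarith [norm_nonneg (σ s - τ s), norm_nonneg c]
  intro σ hσ ε hε
  obtain ⟨τ, hτ, h⟩ := exists_mem_C0Span_approx hσ (S := Set.image2 (pureSection 𝓗 𝓚 a b) S₁ S₂)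
    (fun z ε hε => by
      obtain ⟨σ', hσ', h1⟩ := hσ.1 z (ε / 2) (half_pos hε)
      obtain ⟨τ, hτ, h2⟩ := alg σ' hσ' z (ε / 2) (half_pos hε)
      refine ⟨τ, hτ, ?_⟩
      filter_upwards [h1, h2] with s h3 h4
      linarith [norm_sub_le_norm_sub_add_norm_sub (σ s) (σ' s) (τ s)]) hε
  obtain ⟨n, f, s, hs⟩ := exists_sum_of_mem_C0Span hτ
  exact ⟨n, f, s, fun z => by rw [← hs]; exact h z⟩

end HilbertField

/-! ### Amenability of tensor products -/

/-- Stated over a normed ring to serve both the real norms and the complex coefficients. The error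
is `1 - PQ = (1 - P) + (1 - Q) - (1 - P)(1 - Q)`. -/
theorem tendstoUniformlyOn_mul_one {R ι κ α β γ : Type*} [NormedRing R] [Preorder ι]
    [Preorder κ] {p : ι → α → R} {q : κ → β → R} {k : γ → α} {l : γ → β} {s : Set α} {t : Set β}
    {K : Set γ} (hk : Set.MapsTo k K s) (hl : Set.MapsTo l K t)
    (hp : TendstoUniformlyOn p (fun _ => 1) atTop s)
    (hq : TendstoUniformlyOn q (fun _ => 1) atTop t) :
    TendstoUniformlyOn (fun (i : ι × κ) x => p i.1 (k x) * q i.2 (l x)) (fun _ => 1) atTop K := by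
  rw [Metric.tendstoUniformlyOn_iff] at hp hq ⊢
  intro ε hε
  -- The bound `δ ≤ 1` controls the quadratic error by a linear one; three linear errors then stay
  -- below `ε`.
  set δ : ℝ := min 1 (ε / 3)
  have hδ0 : 0 < δ := lt_min one_pos (by positivity)
  have h1 : δ ≤ 1 := min_le_left _ _
  have h2 : δ ≤ ε / 3 := min_le_right _ _
  rw [← prod_atTop_atTop_eq]
  filter_upwards [tendsto_fst.eventually (hp δ hδ0), tendsto_snd.eventually (hq δ hδ0)]
    with i hi hj x hx
  have h3 := hi _ (hk hx)
  have h4 := hj _ (hl hx)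
  rw [dist_eq_norm] at h3 h4 ⊢
  set P := p i.1 (k x)
  set Q := q i.2 (l x)
  have e : 1 - P * Q = (1 - P) + ((1 - Q) - (1 - P) * (1 - Q)) := by noncomm_ring
  rw [e]
  have h5 := norm_add_le (1 - P) ((1 - Q) - (1 - P) * (1 - Q))
  have h6 := norm_sub_le (1 - Q) ((1 - P) * (1 - Q))
  have h7 := norm_mul_le (1 - P) (1 - Q)
  have h8 : ‖1 - P‖ * ‖1 - Q‖ ≤ ‖1 - P‖ * 1 := by gcongr; linarith
  linarith

namespace UnitaryRep

variable {X : Type u} [Groupoid.{v} X] [TopologicalSpace X] [TopologicalSpace (Arrows X)]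
  {Y : Type u'} [Groupoid.{v'} Y] [TopologicalSpace Y] [TopologicalSpace (Arrows Y)]
  {Z : Type*} [Groupoid Z] [TopologicalSpace Z] [TopologicalSpace (Arrows Z)]
  [IsLCGroupoid X] [IsLCGroupoid Y] [IsLCGroupoid Z]

omit [IsLCGroupoid X] in
theorem hsSq_act (π : UnitaryRep.{u, v, f} X) (x : Arrows X)
    (A : π.field.fiber x.src →L[ℂ] π.field.fiber x.src) : hsSq (π.act x A) = hsSq A :=
  hsSq_conj _ _

/-- Properness on units is needed only for the trace functions to vanish at infinity; both
convergence statements use only that continuous images of compact sets are compact. -/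
theorem IsAmenable.tensor {π : UnitaryRep.{u, v, f} X} {ρ : UnitaryRep.{u', v', f'} Y}
    (hπ : π.IsAmenable.{w}) (hρ : ρ.IsAmenable.{w}) {F : Z ⥤ X} {F' : Z ⥤ Y}
    (hF : Continuous (Arrows.mapFunctor F)) (hF' : Continuous (Arrows.mapFunctor F'))
    (hab : Tendsto (fun z => (F.obj z, F'.obj z)) (cocompact Z) (cocompact (X × Y))) :
    (π.tensor ρ F F' hF hF').IsAmenable.{w} := by
  have := t2Space_base (X := X)
  have := locallyCompactSpace_base (X := X)
  have := t2Space_base (X := Y)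
  have := locallyCompactSpace_base (X := Y)
  have := t2Space_base (X := Z)
  have := locallyCompactSpace_base (X := Z)
  have ha := continuous_obj_of_continuous_arrows hF
  have hb := continuous_obj_of_continuous_arrows hF'
  obtain ⟨ι, _, _, _, T, hT, hT1, hT2⟩ := hπ
  obtain ⟨κ, _, _, _, S, hS, hS1, hS2⟩ := hρ
  have fT : ∀ i u, hsSq ((T i).localization u) ≠ ∞ := fun i u =>
    ((AdjointableOp.hsSq_localization_le_one (hT i).2 u).trans_lt ENNReal.one_lt_top).ne
  have fS : ∀ i u, hsSq ((S i).localization u) ≠ ∞ := fun i u =>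
    ((AdjointableOp.hsSq_localization_le_one (hS i).2 u).trans_lt ENNReal.one_lt_top).ne
  let R : ι × κ → AdjointableOp (π.tensor ρ F F' hF hF').field := fun i =>
    (T i.1).tensor ha hb (S i.2)
      (AdjointableOp.norm_localization_le_one (hT i.1).2)
      (AdjointableOp.norm_localization_le_one (hS i.2).2)
  have hR : ∀ i z, (R i).localization z =
      tensorOp ((T i.1).localization (F.obj z)) ((S i.2).localization (F'.obj z)) := fun i z =>
    AdjointableOp.localization_tensor ha hb _ _ _ _ z
  have hdir : IsDirected (ι × κ) (· ≤ ·) := ⟨fun p q =>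
    let ⟨i, h1, h2⟩ := exists_ge_ge p.1 q.1
    let ⟨j, h3, h4⟩ := exists_ge_ge p.2 q.2
    ⟨(i, j), ⟨h1, h3⟩, ⟨h2, h4⟩⟩⟩
  refine ⟨ι × κ, inferInstance, hdir, inferInstance, R, fun i => ⟨?_, ?_⟩, ?_, ?_⟩
  · obtain ⟨f, hf⟩ := (hT i.1).1
    obtain ⟨g, hg⟩ := (hS i.2).1
    refine ⟨⟨⟨fun z => f (F.obj z) * g (F'.obj z),
      (f.continuous.comp ha).mul (g.continuous.comp hb)⟩,
      (tendsto_mul_cocompact_nhds_zero f.continuous g.continuous f.zero_at_infty'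
        g.zero_at_infty').comp hab⟩, fun z => ?_⟩
    rw [hR]
    refine (hsSq_tensorOp _ _).trans ?_
    rw [hf, hg, ← ENNReal.coe_mul]
    rfl
  · refine iSup_le fun z => ?_
    rw [hR]
    refine (hsNorm_tensorOp _ _).trans_le ?_
    exact mul_le_one' ((le_iSup (fun u => hsNorm ((T i.1).localization u)) _).trans (hT i.1).2)
      ((le_iSup (fun u => hsNorm ((S i.2).localization u)) _).trans (hS i.2).2)
  · intro K hK
    refine (tendstoUniformlyOn_mul_one (Set.mapsTo_image F.obj K) (Set.mapsTo_image F'.obj K)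
      (hT1 _ (hK.image ha)) (hS1 _ (hK.image hb))).congr (Eventually.of_forall fun i z _ => ?_)
    change _ = (hsNorm ((R i).localization z)).toReal
    rw [hR]
    refine .trans ?_ (congrArg ENNReal.toReal (hsNorm_tensorOp _ _)).symm
    rw [ENNReal.toReal_mul]
  · intro K hK
    refine (tendstoUniformlyOn_mul_one (Set.mapsTo_image (Arrows.mapFunctor F) K)
      (Set.mapsTo_image (Arrows.mapFunctor F') K)
      (hT2 _ (hK.image hF)) (hS2 _ (hK.image hF'))).congr (Eventually.of_forall fun i x _ => ?_)
    change _ = hsInner ((π.tensor ρ F F' hF hF').act x ((R i).localization x.src))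
      ((R i).localization x.tgt)
    rw [hR, hR]
    -- The arrow acts on each factor separately, so the coefficient of `T ⊗ S` is the product of the
    -- coefficients of `T` and `S`.
    have h := tensorMap_conj (π.map (F.map x.hom)) (ρ.map (F'.map x.hom))
      ((T i.1).localization (F.obj x.src)) ((S i.2).localization (F'.obj x.src))
    refine .trans ?_ (congrArg (fun A => hsInner A (tensorOp ((T i.1).localization (F.obj x.tgt))
      ((S i.2).localization (F'.obj x.tgt)))) h).symm
    refine (hsInner_tensorOp ?_ (fT _ _) ?_ (fS _ _)).symm
    · rw [hsSq_act]
      exact fT _ _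
    · rw [hsSq_act]
      exact fS _ _

end UnitaryRep

end GroupoidRep

end

theorem proposition3p9
    {X : Type u} [CategoryTheory.Groupoid.{v} X] [TopologicalSpace X]
    [TopologicalSpace (GroupoidRep.Arrows X)] [GroupoidRep.IsLCGroupoid X]
    {Y : Type u'} [CategoryTheory.Groupoid.{v'} Y] [TopologicalSpace Y]
    [TopologicalSpace (GroupoidRep.Arrows Y)] [GroupoidRep.IsLCGroupoid Y] :
    (∀ (π : GroupoidRep.UnitaryRep.{u, v, f} X) (ρ : GroupoidRep.UnitaryRep.{u', v', f'} Y),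
      π.field.CountablyGenerated → ρ.field.CountablyGenerated →
      π.IsAmenable.{w} → ρ.IsAmenable.{w} →
        (π.outerTensor ρ).field.CountablyGenerated ∧ (π.outerTensor ρ).IsAmenable.{w}) ∧
    (∀ (π : GroupoidRep.UnitaryRep.{u, v, f} X) (ρ : GroupoidRep.UnitaryRep.{u, v, f'} X),
      π.field.CountablyGenerated → ρ.field.CountablyGenerated →
      π.IsAmenable.{w} → ρ.IsAmenable.{w} →
        (π.innerTensor ρ).field.CountablyGenerated ∧ (π.innerTensor ρ).IsAmenable.{w}) := by
  have := GroupoidRep.t2Space_base (X := X)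
  have := GroupoidRep.locallyCompactSpace_base (X := X)
  have := GroupoidRep.t2Space_base (X := Y)
  have := GroupoidRep.locallyCompactSpace_base (X := Y)
  -- The diagonal is proper: the preimage of a compact `K` lies in the first projection of `K`. For
  -- the outer product the corresponding map is the identity of `X × Y`.
  have hdiag : Tendsto (fun x : X => (x, x)) (cocompact X) (cocompact (X × X)) :=
    fun s hs =>
      let ⟨K, hK, h⟩ := mem_cocompact.1 hs
      mem_cocompact.2 ⟨Prod.fst '' K, hK.image continuous_fst,
        fun x hx => h fun hx' => hx ⟨_, hx', rfl⟩⟩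
  exact ⟨fun π ρ h₁ h₂ h₃ h₄ =>
    ⟨h₁.tensor h₂ continuous_fst continuous_snd tendsto_id, h₃.tensor h₄ _ _ tendsto_id⟩,
    fun π ρ h₁ h₂ h₃ h₄ => ⟨h₁.tensor h₂ continuous_id continuous_id hdiag,
      h₃.tensor h₄ _ _ hdiag⟩⟩
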